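/- **Conventions.** A *Whitney stratified manifold* is a smooth (Hausdorff, second countable) manifold $X$ with a locally finite decomposition $X=\bigsqcup_{i\in\mathcal S}S_i$ into disjoint, locally closed, connected smooth submanifolds (strata), indexed by a poset, such that $S_i\cap\overline{S_j}\neq\emptyset \iff S_i\subset\overline{S_j}\iff i\le j$, and such that Whitney's condition (B) holds for every pair of strata. It is *based* if it is equipped with a generic basepoint $\star$, i.e. one in an open stratum. Write $N_xA=T_xX/T_xA$ for the normal space of a stratum $A$ of $X$ at $x\in A$. A smooth map $f:M\to X$ from a manifold is *transversal* if for every $p\in M$ the map $T_pM\to N_{f(p)}B$ induced by $df$ is surjective, where $B$ is the stratum through $f(p)$. A smooth map $g:X\to Y$ of Whitney stratified manifolds is a *stratified normal submersion* if $g^{-1}(B)$ is a union of strata of $X$ for each stratum $B$ of $Y$, and $N_xA\to N_{g(x)}B$ is surjective for all strata $A\subset g^{-1}(B)$ and all $x\in A$. Let $\mathrm{Whit}_\star$ be the category of based Whitney stratified manifolds and basepoint-preserving stratified normal submersions. A *homotopy* in $\mathrm{Whit}_\star$ from $s$ to $s'$ is a stratified normal submersion $h:X\times[0,1]\to Y$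 (product stratification, $[0,1]$ having strata $\{0\},(0,1),\{1\}$) with $h_0=s$, $h_1=s'$ and each slice $h_t$ a morphism of $\mathrm{Whit}_\star$; homotopy equivalences in $\mathrm{Whit}_\star$ are defined accordingly. A *dagger monoid* is a monoid with an anti-involution $a\mapsto a^\dagger$, i.e. $a^{\dagger\dagger}=a$, $(ab)^\dagger=b^\dagger a^\dagger$, $1^\dagger=1$; its morphisms preserve unit, product and $\dagger$. Let $n>0$. Fix on $S^n$ a basepoint $\star$ and the closed disk-shaped neighbourhood $B^n$ of $\star$ given, in stereographic coordinates $S^n\setminus\{\star\}\cong\mathbb R^n$, by $\{|y|\ge 4\}\cup\{\star\}$. Fix a unit vector $e\in\mathbb R^n$ and the map $\mu:(S^n,B^n)\to(S^n\vee S^n,\star)$ which carries the unit balls about $-2e$ and $2e$ by similarities $y\mapsto 4(y\pm2e)$ onto the two copies of $S^n\setminus B^n$, carries the concentric balls of radius $2$ onto the two copies of $S^n\setminus\{\star\}$ by a further radial smooth stretching, and sends everything else to the wedge point. Let $\rho:S^n\to S^n$ be the reflection in the hyperplane through $\star$ orthogonal to $e$. For $X$ in $\mathrm{Whit}_\star$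 let $\psi_n(X)$ be the set of smooth transversal maps $f:(S^n,B^n)\to(X,\star)$ modulo homotopy through such maps, that is, modulo smooth maps $h:S^n\times[0,1]\to X$ all of whose slices $h_t$ are such maps and for which $h_t$ is independent of $t$ near $t=0$ and near $t=1$. Write $[f]$ for the class of $f$. **Theorem.** Let $n>0$. Homotopy through transversal maps is an equivalence relation, and $\psi_n(X)$ is a dagger monoid with unit the class of the constant map at $\star$, product $[f]\cdot[g]=[(f\vee g)\circ\mu]$ and anti-involution $[f]^\dagger=[f\circ\rho]$ (in particular these are well defined). For a morphism $s:X\to Y$ of $\mathrm{Whit}_\star$ the formula $\psi_n(s)[f]=[s\circ f]$ defines a map of dagger monoids $\psi_n(X)\to\psi_n(Y)$, and in this way $\psi_n$ is a functor from $\mathrm{Whit}_\star$ to the category of dagger monoids. If $s$ and $s'$ are homotopic in $\mathrm{Whit}_\star$, then $\psi_n(s)=\psi_n(s')$. Consequently, if $X$ and $Y$ are homotopy equivalent in $\mathrm{Whit}_\star$, then $\psi_n(X)$ and $\psi_n(Y)$ are isomorphic dagger monoids. -/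

import Mathlib

open Set Filter Topology Manifold CategoryTheory
open scoped ContDiff

universe u

/-! ### Strata, tangent spaces, transversality -/

section Strata

variable {E : Type*} [NormedAddCommGroup E] [NormedSpace ℝ E] {H : Type*} [TopologicalSpace H]
  {M : Type*} [TopologicalSpace M] [ChartedSpace H M]
  {E' : Type*} [NormedAddCommGroup E'] [NormedSpace ℝ E'] {H' : Type*} [TopologicalSpace H']
  {N : Type*} [TopologicalSpace N] [ChartedSpace H' N]
  {E'' : Type*} [NormedAddCommGroup E''] [NormedSpace ℝ E''] {H'' : Type*} [TopologicalSpace H'']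
  {P : Type*} [TopologicalSpace P] [ChartedSpace H'' P]
  {ι κ l : Type*}

/-- The tangent space `T_p S ⊆ T_p M` of a submanifold `S` of `M`: the velocities at `p` of smooth
curves in `M` which stay in `S`. (For a submanifold these velocities already form a linear
subspace, so that taking the span changes nothing; it makes the definition a `Submodule`.) -/
noncomputable def tangentTo (I : ModelWithCorners ℝ E H) (S : Set M) (p : M) :
    Submodule ℝ (TangentSpace I p) :=
  Submodule.span ℝ {v : E | ∃ γ : ℝ → M, ContMDiff 𝓘(ℝ, ℝ) I ∞ γ ∧ (∀ t, γ t ∈ S) ∧ γ 0 = p ∧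
    (mfderiv 𝓘(ℝ, ℝ) I γ 0 (1 : ℝ) : E) = v}

/-- The composite `T_p M → T_{f p} N → T_{f p} N / T_{f p} B = N_{f p} B` of the differential of `f`
with the projection to the normal space of `B`. -/
noncomputable def toNormal (I : ModelWithCorners ℝ E H) (J : ModelWithCorners ℝ E' H') (B : Set N)
    (f : M → N) (p : M) :
    TangentSpace I p → TangentSpace J (f p) ⧸ tangentTo J B (f p) :=
  fun v => (tangentTo J B (f p)).mkQ (mfderiv I J f p v)

/-- A smooth map from a manifold `M` to a manifold `N` decomposed into strata `B j` is transversal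
if at each point `p` the map from `T_p M` to the normal space of the stratum through `f p` is
surjective. -/
structure IsTransversal (I : ModelWithCorners ℝ E H) (J : ModelWithCorners ℝ E' H')
    (B : κ → Set N) (f : M → N) : Prop where
  smooth : ContMDiff I J ∞ f
  surjective : ∀ p j, f p ∈ B j → Function.Surjective (toNormal I J (B j) f p)

/-- A smooth map `f : M → N` of manifolds decomposed into strata `A i`, `B j` respectively is a
stratified normal submersion if the inverse image of every stratum of `N` is a union of strata of
`M`, and for strata `A ⊆ f⁻¹ B` and `x ∈ A` the map `N_x A → N_{f x} B` of normal spaces is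
surjective. As `T_x M → N_x A` is onto, the latter says that the composite
`T_x M → N_x A → N_{f x} B` is surjective. -/
structure IsStratifiedNormalSubmersion (I : ModelWithCorners ℝ E H) (J : ModelWithCorners ℝ E' H')
    (A : ι → Set M) (B : κ → Set N) (f : M → N) : Prop where
  smooth : ContMDiff I J ∞ f
  stratified : ∀ j, ∃ K : Set ι, f ⁻¹' B j = ⋃ i ∈ K, A i
  surjective : ∀ i j, A i ⊆ f ⁻¹' B j → ∀ x ∈ A i, Function.Surjective (toNormal I J (B j) f x)

/-- A subset `S` of a `d`-manifold `M` is an (embedded, smooth) submanifold if around each of its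
points there is a chart in which `S` is a linear slice. -/
def IsSubmanifold {d : ℕ} {M : Type*} [TopologicalSpace M]
    [ChartedSpace (EuclideanSpace ℝ (Fin d)) M] (S : Set M) : Prop :=
  ∀ p ∈ S, ∃ φ ∈ IsManifold.maximalAtlas (𝓡 d) ∞ M, p ∈ φ.source ∧
    ∃ V : Submodule ℝ (EuclideanSpace ℝ (Fin d)),
      ∀ q ∈ φ.source, q ∈ S ↔ φ q - φ p ∈ V

/-- The tangent space `T_q S` of a submanifold `S` of a `d`-manifold, read in a chart `φ`. -/
noncomputable def tangentInChart {d : ℕ} {M : Type*} [TopologicalSpace M]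
    [ChartedSpace (EuclideanSpace ℝ (Fin d)) M]
    (φ : OpenPartialHomeomorph M (EuclideanSpace ℝ (Fin d))) (S : Set M) (q : M) :
    Submodule ℝ (EuclideanSpace ℝ (Fin d)) :=
  show Submodule ℝ (TangentSpace (𝓡 d) (φ q)) from
    (tangentTo (𝓡 d) S q).map (mfderiv (𝓡 d) (𝓡 d) φ q).toLinearMap

/-- Whitney's condition (B) for the pair of strata `S`, `T` of a `d`-manifold at points `x` of `S`:
if `u k ∈ S` and `v k ∈ T` both converge to `x`, the secant lines `u k, v k` converge to `L` and the
tangent spaces of `T` at `v k` converge to `P`, then `L ≤ P`. Lines and planes are read in a chart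
`φ` around `x`, and convergence in the Grassmannian is convergence of orthogonal projections. -/
def WhitneyB {d : ℕ} {M : Type*} [TopologicalSpace M]
    [ChartedSpace (EuclideanSpace ℝ (Fin d)) M] (S T : Set M) : Prop :=
  ∀ x ∈ S, ∀ φ ∈ IsManifold.maximalAtlas (𝓡 d) ∞ M, x ∈ φ.source →
    ∀ u v : ℕ → M, (∀ k, u k ∈ S) → (∀ k, v k ∈ T) → (∀ k, u k ≠ v k) →
      Tendsto u atTop (𝓝 x) → Tendsto v atTop (𝓝 x) →
      ∀ L P : Submodule ℝ (EuclideanSpace ℝ (Fin d)),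
        Tendsto (fun k => (Submodule.span ℝ {φ (v k) - φ (u k)}).starProjection) atTop
          (𝓝 L.starProjection) →
        Tendsto (fun k => (tangentInChart φ T (v k)).starProjection) atTop (𝓝 P.starProjection) →
        L ≤ P

/-- A Whitney stratification of a `d`-manifold `M`: a locally finite decomposition into disjoint,
locally closed, connected submanifolds `S i`, indexed by a poset, with the frontier condition and
Whitney's condition (B). -/
structure IsWhitneyStratification {d : ℕ} {M : Type*} [TopologicalSpace M]
    [ChartedSpace (EuclideanSpace ℝ (Fin d)) M] [PartialOrder ι] (S : ι → Set M) : Prop where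
  cover : ⋃ i, S i = univ
  disjoint : Pairwise (Function.onFun Disjoint S)
  locallyFinite : LocallyFinite S
  frontier : ∀ i j, (S i ∩ closure (S j)).Nonempty ↔ S i ⊆ closure (S j)
  le_iff : ∀ i j, i ≤ j ↔ S i ⊆ closure (S j)
  isLocallyClosed : ∀ i, IsLocallyClosed (S i)
  isConnected : ∀ i, IsConnected (S i)
  isSubmanifold : ∀ i, IsSubmanifold (d := d) (S i)
  whitneyB : ∀ i j, i ≤ j → WhitneyB (d := d) (S i) (S j)

theorem mfderiv_mem_tangentTo {I : ModelWithCorners ℝ E H} {J : ModelWithCorners ℝ E' H'}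
    {f : M → N} (hf : ContMDiff I J ∞ f) {S : Set M} {T : Set N} (h : S ⊆ f ⁻¹' T) {p : M}
    {v : TangentSpace I p} (hv : v ∈ tangentTo I S p) :
    mfderiv I J f p v ∈ tangentTo J T (f p) := by
  have hle : tangentTo I S p ≤
      (tangentTo J T (f p)).comap (mfderiv I J f p).toLinearMap := by
    refine Submodule.span_le.2 ?_
    rintro w ⟨γ, hγ, hS, rfl, rfl⟩
    refine Submodule.subset_span ⟨f ∘ γ, hf.comp hγ, fun t => h (hS t), rfl, ?_⟩
    rw [mfderiv_comp (I' := I) 0 (hf.mdifferentiable (by simp) _)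
      (hγ.mdifferentiable (by simp) _)]
    rfl
  exact hle hv

theorem toNormal_surjective_iff {I : ModelWithCorners ℝ E H} {J : ModelWithCorners ℝ E' H'}
    {B : Set N} {f : M → N} {p : M} :
    Function.Surjective (toNormal I J B f p) ↔
      ∀ w : TangentSpace J (f p), ∃ v : TangentSpace I p,
        mfderiv I J f p v - w ∈ tangentTo J B (f p) := by
  constructor
  · intro h w
    obtain ⟨v, hv⟩ := h ((tangentTo J B (f p)).mkQ w)
    exact ⟨v, (Submodule.Quotient.eq _).1 hv⟩
  · intro h w
    obtain ⟨w, rfl⟩ := Submodule.mkQ_surjective _ w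
    obtain ⟨v, hv⟩ := h w
    exact ⟨v, (Submodule.Quotient.eq _).2 hv⟩

theorem toNormal_comp_surjective {I : ModelWithCorners ℝ E H} {J : ModelWithCorners ℝ E' H'}
    {K : ModelWithCorners ℝ E'' H''} {f : M → N} {g : N → P}
    (hf : ContMDiff I J ∞ f) (hg : ContMDiff J K ∞ g) {B : Set N} {C : Set P}
    (h : B ⊆ g ⁻¹' C) {x : M} (h1 : Function.Surjective (toNormal I J B f x))
    (h2 : Function.Surjective (toNormal J K C g (f x))) :
    Function.Surjective (toNormal I K C (g ∘ f) x) := by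
  rw [toNormal_surjective_iff] at *
  intro w
  obtain ⟨v, hv⟩ := h2 w
  obtain ⟨z, hz⟩ := h1 v
  refine ⟨z, ?_⟩
  have e : mfderiv I K (g ∘ f) x z = mfderiv J K g (f x) (mfderiv I J f x z) := by
    rw [mfderiv_comp (I' := J) x (hg.mdifferentiable (by simp) _)
      (hf.mdifferentiable (by simp) _)]
    rfl
  have := Submodule.add_mem _ (mfderiv_mem_tangentTo hg h hz) hv
  rw [map_sub, sub_add_sub_cancel] at this
  rw [e]
  exact this

theorem subset_of_mem_of_stratified {M : Type*} {A : ι → Set M} (hA : Pairwise (Function.onFun Disjoint A))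
    {U : Set M} (hU : ∃ K : Set ι, U = ⋃ i ∈ K, A i) {i : ι} {x : M} (hx : x ∈ A i)
    (hxU : x ∈ U) : A i ⊆ U := by
  obtain ⟨K, rfl⟩ := hU
  obtain ⟨i', hi', hx'⟩ := mem_iUnion₂.1 hxU
  have : i = i' := by
    by_contra hne
    exact Set.disjoint_left.1 (hA hne) hx hx'
  subst this
  exact subset_biUnion_of_mem (u := A) hi'

theorem isStratifiedNormalSubmersion_id (I : ModelWithCorners ℝ E H) (A : ι → Set M) :
    IsStratifiedNormalSubmersion I I A A id where
  smooth := contMDiff_id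
  stratified := fun j => ⟨{j}, by simp⟩
  surjective := by
    intro i j _ x _
    rw [toNormal_surjective_iff]
    intro (w : TangentSpace I x)
    have e : mfderiv I I (id : M → M) x w = w := by
      rw [mfderiv_id]
      rfl
    refine ⟨w, ?_⟩
    rw [e, sub_self]
    exact Submodule.zero_mem _

theorem IsStratifiedNormalSubmersion.comp {I : ModelWithCorners ℝ E H}
    {J : ModelWithCorners ℝ E' H'} {K : ModelWithCorners ℝ E'' H''}
    {A : ι → Set M} {B : κ → Set N} {C : l → Set P}
    (hA : Pairwise (Function.onFun Disjoint A)) (hB : Pairwise (Function.onFun Disjoint B))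
    (hBc : ⋃ j, B j = univ) {f : M → N} {g : N → P}
    (hg : IsStratifiedNormalSubmersion J K B C g) (hf : IsStratifiedNormalSubmersion I J A B f) :
    IsStratifiedNormalSubmersion I K A C (g ∘ f) where
  smooth := hg.smooth.comp hf.smooth
  stratified := by
    intro k
    obtain ⟨S, hS⟩ := hg.stratified k
    choose T hT using hf.stratified
    refine ⟨⋃ j ∈ S, T j, ?_⟩
    rw [preimage_comp, hS, preimage_iUnion₂]
    simp only [hT]
    ext x
    simp only [mem_iUnion]
    constructor
    · rintro ⟨j, hj, i, hi, hx⟩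
      exact ⟨i, ⟨j, hj, hi⟩, hx⟩
    · rintro ⟨i, ⟨j, hj, hi⟩, hx⟩
      exact ⟨j, hj, i, hi, hx⟩
  surjective := by
    intro i k hik x hx
    obtain ⟨j, hj⟩ := mem_iUnion.1 (hBc ▸ mem_univ (f x) : f x ∈ ⋃ j, B j)
    have hij : A i ⊆ f ⁻¹' B j := subset_of_mem_of_stratified hA (hf.stratified j) hx hj
    have hjk : B j ⊆ g ⁻¹' C k := subset_of_mem_of_stratified hB (hg.stratified k) hj (hik hx)
    exact toNormal_comp_surjective hf.smooth hg.smooth hjk (hf.surjective i j hij x hx)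
      (hg.surjective j k hjk (f x) hj)

end Strata

/-! ### The category of based Whitney stratified manifolds -/

/-- A based Whitney stratified manifold: a smooth (Hausdorff, second countable) manifold of some
dimension with a Whitney stratification and a generic basepoint, i.e. one in an open stratum. -/
structure BasedWhit where
  carrier : Type u
  dim : ℕ
  [top : TopologicalSpace carrier]
  [t2 : T2Space carrier]
  [secondCountable : SecondCountableTopology carrier]
  [charted : ChartedSpace (EuclideanSpace ℝ (Fin dim)) carrier]
  [manifold : IsManifold (𝓡 dim) ∞ carrier]
  Index : Type u
  [order : PartialOrder Index]
  stratum : Index → Set carrier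
  whitney : IsWhitneyStratification (d := dim) stratum
  base : carrier
  generic : ∃ i, IsOpen (stratum i) ∧ base ∈ stratum i

namespace BasedWhit

attribute [instance] top t2 secondCountable charted manifold order

instance : CoeSort BasedWhit.{u} (Type u) := ⟨carrier⟩

/-- A morphism: a based stratified normal submersion. -/
@[ext]
structure Hom (X Y : BasedWhit.{u}) where
  toFun : X → Y
  isSubmersion : IsStratifiedNormalSubmersion (𝓡 X.dim) (𝓡 Y.dim) X.stratum Y.stratum toFun
  map_base : toFun X.base = Y.base

instance : Category BasedWhit.{u} where
  Hom := Hom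
  id X := ⟨id, isStratifiedNormalSubmersion_id _ _, rfl⟩
  comp {X Y Z} f g := ⟨g.toFun ∘ f.toFun,
    .comp X.whitney.disjoint Y.whitney.disjoint Y.whitney.cover g.isSubmersion f.isSubmersion,
    by simp [f.map_base, g.map_base]⟩

/-- The function underlying a morphism. -/
def fn {X Y : BasedWhit.{u}} (s : X ⟶ Y) : X → Y := Hom.toFun s

/-- The strata `{0}`, `(0, 1)`, `{1}` of the unit interval. -/
def intervalStratum : Fin 3 → Set unitInterval := ![{0}, Ioo 0 1, {1}]

/-- Homotopy of based maps: a stratified normal submersion `h : X × [0, 1] → Y`, where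
`X × [0, 1]` has the product stratification, each slice of which is a based stratified normal
submersion. -/
def Homotopic {X Y : BasedWhit.{u}} (s s' : X ⟶ Y) : Prop :=
  ∃ h : X × unitInterval → Y,
    IsStratifiedNormalSubmersion ((𝓡 X.dim).prod (𝓡∂ 1)) (𝓡 Y.dim)
      (fun k : X.Index × Fin 3 => X.stratum k.1 ×ˢ intervalStratum k.2) Y.stratum h ∧
    (∀ t, IsStratifiedNormalSubmersion (𝓡 X.dim) (𝓡 Y.dim) X.stratum Y.stratum
      (fun x => h (x, t))) ∧
    (∀ t, h (X.base, t) = Y.base) ∧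
    (∀ x, h (x, 0) = fn s x) ∧ (∀ x, h (x, 1) = fn s' x)

/-- Homotopy equivalence of based Whitney stratified manifolds. -/
def HomotopyEquivalent (X Y : BasedWhit.{u}) : Prop :=
  ∃ (s : X ⟶ Y) (r : Y ⟶ X), Homotopic (s ≫ r) (𝟙 X) ∧ Homotopic (r ≫ s) (𝟙 Y)

end BasedWhit

/-! ### Dagger monoids -/

/-- Dagger monoids: monoids with an anti-involution `star`. -/
structure DaggerMonCat where
  carrier : Type u
  [monoid : Monoid carrier]
  [starMul : StarMul carrier]

namespace DaggerMonCat

attribute [instance] monoid starMul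

instance : CoeSort DaggerMonCat.{u} (Type u) := ⟨carrier⟩

/-- Maps of dagger monoids preserve unit, product and anti-involution. -/
instance : Category DaggerMonCat.{u} where
  Hom M N := M →⋆* N
  id M := StarMonoidHom.id M
  comp f g := g.comp f

/-- The function underlying a map of dagger monoids. -/
def fn {M N : DaggerMonCat.{u}} (f : M ⟶ N) : M → N := (show M →⋆* N from f)

end DaggerMonCat

/-! ### The sphere, its cap, the pinch map and the reflection -/

/-- The unit sphere `S^n` in `ℝ^{n+1}`. -/
abbrev Sph (n : ℕ) : Type := Metric.sphere (0 : EuclideanSpace ℝ (Fin (n + 1))) 1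

namespace Sph

/-- The last basis vector of `ℝ^{n+1}`. -/
noncomputable abbrev pole (n : ℕ) : EuclideanSpace ℝ (Fin (n + 1)) :=
  EuclideanSpace.single (Fin.last n) 1

theorem norm_pole (n : ℕ) : ‖pole n‖ = 1 := by simp

/-- The basepoint of `S^n`. -/
noncomputable def base (n : ℕ) : Sph n := ⟨pole n, by simp⟩

/-- The disk-shaped closed neighbourhood `B^n` of the basepoint. In stereographic coordinates it is
the complement of the open ball of radius `4`, together with the point at infinity. -/
def cap (n : ℕ) : Set (Sph n) := {x | 3 / 5 ≤ x.1 (Fin.last n)}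

/-- The hyperplane orthogonal to the basepoint, target of the stereographic projection
`S^n - ⋆ → ℝ^n`. -/
abbrev Plane (n : ℕ) : Type := (Submodule.span ℝ {pole n})ᗮ

variable {n : ℕ}

/-- The unit vector of `Plane n` along which the sphere is pinched and reflected. -/
noncomputable def axis (n : ℕ) [NeZero n] : Plane n :=
  ⟨EuclideanSpace.single 0 1, by
    rw [Submodule.mem_orthogonal_singleton_iff_inner_right]
    have : Fin.last n ≠ 0 := by
      rw [Ne, Fin.ext_iff]
      simpa using NeZero.ne n
    simp [pole, EuclideanSpace.inner_single_left, this]⟩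

theorem norm_axis (n : ℕ) [NeZero n] : ‖axis n‖ = 1 := by
  simp [axis]

/-- The collapse `ℝ^n → S^n`: inverse stereographic projection on the ball of radius `4`, constant
at the basepoint outside the ball of radius `8`; in between it stretches radially, by a smooth
factor which becomes infinite at radius `8`. -/
noncomputable def collapse (y : Plane n) : Sph n :=
  if ‖y‖ < 8 then
    (stereographic (norm_pole n)).symm ((Real.smoothTransition (2 - ‖y‖ / 4))⁻¹ • y)
  else base n

open Classical in
/-- In stereographic coordinates: enlarge the ball of radius `1` about `a` to the ball of radius
`4` about `0` by a similarity, then collapse. -/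
noncomputable def pinchHalf (a : Plane n) (x : Sph n) : Sph n :=
  if x = base n then base n
  else collapse ((4 : ℝ) • (stereographic (norm_pole n) x - a))

/-- The wedge `S^n ∨ S^n`. -/
def Wedge (n : ℕ) : Type := {p : Sph n × Sph n // p.1 = base n ∨ p.2 = base n}

/-- The pinch map `μ : (S^n, B^n) → (S^n ∨ S^n, ⋆)`. It restricts to diffeomorphisms from the
unit balls about `-2 • axis` and `2 • axis` (in stereographic coordinates) to the two copies of
`S^n - B^n`, and sends everything outside the concentric balls of radius `2` to the wedge point. -/
noncomputable def pinch [NeZero n] (x : Sph n) : Wedge n :=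
  ⟨(pinchHalf (-(2 : ℝ) • axis n) x, pinchHalf ((2 : ℝ) • axis n) x), by
    by_cases hx : x = base n
    · simp [pinchHalf, hx]
    have key : ∀ (ε : ℝ), |ε| = 1 →
        0 ≤ ε * inner ℝ (stereographic (norm_pole n) x) (axis n) →
        pinchHalf (-(2 * ε) • axis n) x = base n := by
      intro ε hε h
      rw [pinchHalf, if_neg hx, collapse, if_neg]
      rw [not_lt]
      have hn := norm_axis n
      have hε2 : ε * ε = 1 := by rw [← abs_mul_abs_self, hε, one_mul]
      have h1 := real_inner_le_norm
        ((4 : ℝ) • (stereographic (norm_pole n) x - -(2 * ε) • axis n)) (ε • axis n)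
      rw [norm_smul ε, hn, Real.norm_eq_abs, hε, mul_one, mul_one, real_inner_smul_left,
        inner_sub_left, real_inner_smul_left, real_inner_smul_right, real_inner_smul_right,
        real_inner_self_eq_norm_sq, hn] at h1
      nlinarith
    rcases le_total 0 (inner ℝ (stereographic (norm_pole n) x) (axis n)) with h | h
    · left
      simpa using key 1 (by simp) (by simpa using h)
    · right
      simpa using key (-1) (by simp) (by simpa using h)⟩

open Classical in
/-- The map `f ∨ g : S^n ∨ S^n → X` given by based maps `f` and `g`. -/
noncomputable def wedgeMap {X : Type*} (f g : Sph n → X) (p : Wedge n) : X :=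
  if p.1.2 = base n then f p.1.1 else g p.1.2

/-- The reflection `ρ` of `S^n` in the hyperplane orthogonal to `axis n`, which contains the
basepoint. -/
noncomputable def rho [NeZero n] (x : Sph n) : Sph n :=
  ⟨(Submodule.span ℝ {(axis n : EuclideanSpace ℝ (Fin (n + 1)))})ᗮ.reflection x.1, by
    simp⟩

end Sph

/-! ### Transversal homotopy -/

/-- Smooth transversal maps `(S^n, B^n) → (X, ⋆)`. -/
structure TransversalSphere (n : ℕ) (X : BasedWhit.{u}) where
  toFun : Sph n → X
  isTransversal : IsTransversal (𝓡 n) (𝓡 X.dim) X.stratum toFun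
  map_cap : ∀ x ∈ Sph.cap n, toFun x = X.base

namespace TransversalSphere

/-- Homotopy through transversal maps `(S^n, B^n) → (X, ⋆)`: a smooth map on `S^n × [0, 1]`, all of
whose slices are such maps, and which is constant in time near both ends. -/
def Homotopic {n : ℕ} {X : BasedWhit.{u}} (f g : TransversalSphere n X) : Prop :=
  ∃ h : Sph n × unitInterval → X,
    ContMDiff ((𝓡 n).prod (𝓡∂ 1)) (𝓡 X.dim) ∞ h ∧
    (∀ t, IsTransversal (𝓡 n) (𝓡 X.dim) X.stratum (fun x => h (x, t))) ∧
    (∀ t, ∀ x ∈ Sph.cap n, h (x, t) = X.base) ∧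
    (∃ ε > (0 : ℝ), ∀ x, ∀ t : unitInterval,
      ((t : ℝ) < ε → h (x, t) = f.toFun x) ∧ (1 - ε < (t : ℝ) → h (x, t) = g.toFun x))

end TransversalSphere

/-- The set `ψ_n(X)` of classes of transversal maps `(S^n, B^n) → (X, ⋆)` under homotopy through such
maps. -/
def TransversalHomotopySet (n : ℕ) (X : BasedWhit.{u}) : Type u :=
  Quot (TransversalSphere.Homotopic (n := n) (X := X))

/-- The class `[f]` of a transversal map `f`. -/
def TransversalSphere.cls {n : ℕ} {X : BasedWhit.{u}} (f : TransversalSphere n X) :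
    TransversalHomotopySet n X :=
  Quot.mk _ f

/-!
A transversal map `f : (S^n, B^n) → (X, ⋆)` is treated, in stereographic coordinates, as a map on
`ℝ^n` which is `⋆` outside the open ball of radius `4`. It can be transplanted to any disc inside
this ball with centre on the axis (`BasedWhit.place`), and maps living on disjoint discs can be
united (`BasedWhit.join`). As the stretching in the pinch map takes place where `f` and `g` are
already `⋆`, the product `(f ∨ g) ∘ μ` is the union of `f` and `g` placed in the unit discs about
`∓ 2 • axis` (`BasedWhit.wedgeMap_comp_pinch`).

These operations preserve transversality for two reasons. The basepoint lies in an open stratum,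
whose normal space is zero, so that any map is transversal where its value is `⋆`
(`BasedWhit.toNormal_surjective_of_eq_base`); at every other point the new map is, locally, one of
the given maps composed with a local diffeomorphism of the sphere. A union of smooth maps is smooth
even at points where both maps are `⋆`, since in a chart at `⋆` it is their sum
(`BasedWhit.contMDiff_join`).

Homotopies that are constant near the ends amount to smooth families over the real line
(`TransversalSphere.homotopic_iff_exists_family`): smooth step functions convert one notion into the
other, and glue homotopies. All operations are defined for families, the discs being allowed to move
with time, which makes them compatible with homotopy. The unit and associativity laws hold because
both sides are unions of the same maps in discs lying in the same order on the axis, and one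
configuration of discs can be moved to the other along segments
(`TransversalSphere.mul_assoc_homotopic`). The reflection exchanges the two discs of the product, so
that the laws of the anti-involution hold on the nose. Composition with a stratified normal
submersion `s` preserves transversality and commutes with all operations, and a homotopy `h` of
such maps gives the homotopy `h_t ∘ f`.
-/

/-! ### Transversality at a point -/

section TransversalAt

variable {E : Type*} [NormedAddCommGroup E] [NormedSpace ℝ E] {H : Type*} [TopologicalSpace H]
  {M : Type*} [TopologicalSpace M] [ChartedSpace H M] {I : ModelWithCorners ℝ E H}
  {E' : Type*} [NormedAddCommGroup E'] [NormedSpace ℝ E'] {H' : Type*} [TopologicalSpace H']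
  {N : Type*} [TopologicalSpace N] [ChartedSpace H' N] {J : ModelWithCorners ℝ E' H'}
  {E'' : Type*} [NormedAddCommGroup E''] [NormedSpace ℝ E''] {H'' : Type*} [TopologicalSpace H'']
  {P : Type*} [TopologicalSpace P] [ChartedSpace H'' P] {K : ModelWithCorners ℝ E'' H''}

/-- Surjectivity onto the normal space of a stratum depends only on the germ of the map. -/
theorem toNormal_surjective_congr {B : Set N} {f g : M → N} {p : M} (h : f =ᶠ[𝓝 p] g)
    (hf : Function.Surjective (toNormal I J B f p)) :
    Function.Surjective (toNormal I J B g p) := by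
  -- The tangent spaces at `f p` and `g p` are both the model space `E'`; phrasing the condition
  -- for an arbitrary point and an arbitrary linear map makes the rewriting possible.
  let Q : N → (E →L[ℝ] E') → Prop := fun q L =>
    ∀ w : E', ∃ v : E, (L v - w : E') ∈ (show Submodule ℝ E' from tangentTo J B q)
  have hQf : Q (f p) (mfderiv I J f p) := toNormal_surjective_iff.1 hf
  have hd : (mfderiv I J f p : E →L[ℝ] E') = mfderiv I J g p := h.mfderiv_eq
  rw [h.eq_of_nhds, hd] at hQf
  exact toNormal_surjective_iff.2 hQf

/-- Precomposition with a map of surjective differential preserves transversality. -/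
theorem toNormal_comp_surjective_of_mfderiv_surjective {C : Set P} {θ : M → N} {f : N → P} {p : M}
    (hf : MDifferentiableAt J K f (θ p)) (hθ : MDifferentiableAt I J θ p)
    (hs : Function.Surjective (mfderiv I J θ p))
    (h : Function.Surjective (toNormal J K C f (θ p))) :
    Function.Surjective (toNormal I K C (f ∘ θ) p) := by
  rw [toNormal_surjective_iff] at *
  intro w
  obtain ⟨v, hv⟩ := h w
  obtain ⟨z, rfl⟩ := hs v
  refine ⟨z, ?_⟩
  rw [mfderiv_comp (I' := J) p hf hθ]
  exact hv

theorem mfderiv_surjective_of_rightInverse {θ : M → N} {η : N → M} {p : M}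
    (hθ : MDifferentiableAt I J θ p) (hη : MDifferentiableAt J I η (θ p)) (hp : η (θ p) = p)
    (h : θ ∘ η =ᶠ[𝓝 (θ p)] id) : Function.Surjective (mfderiv I J θ p) := by
  have h1 : HasMFDerivAt J J (θ ∘ η) (θ p)
      ((mfderiv I J θ p : E →L[ℝ] E').comp (mfderiv J I η (θ p) : E' →L[ℝ] E)) := by
    have h0 : HasMFDerivAt I J θ (η (θ p)) (mfderiv I J θ p : E →L[ℝ] E') := by
      rw [hp]
      exact hθ.hasMFDerivAt
    exact HasMFDerivAt.comp (θ p) h0 hη.hasMFDerivAt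
  have h2 : HasMFDerivAt J J (θ ∘ η) (θ p) (ContinuousLinearMap.id ℝ E') :=
    (hasMFDerivAt_id (I := J) (θ p)).congr_of_eventuallyEq h
  have h3 := hasMFDerivAt_unique h1 h2
  intro w
  exact ⟨(mfderiv J I η (θ p) : E' →L[ℝ] E) w, congrArg (fun L : E' →L[ℝ] E' => L w) h3⟩

end TransversalAt

/-- An open subset of a manifold has the full tangent space: the velocity `v` at `p` is realized by
the curve which in a chart is `p + δ sin (t / δ) v`, with `δ` so small that it stays in the set. -/
theorem tangentTo_eq_top_of_isOpen {d : ℕ} {M : Type*} [TopologicalSpace M]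
    [ChartedSpace (EuclideanSpace ℝ (Fin d)) M] [IsManifold (𝓡 d) ∞ M] {U : Set M}
    (hU : IsOpen U) {p : M} (hp : p ∈ U) : tangentTo (𝓡 d) U p = ⊤ := by
  rw [eq_top_iff]
  rintro (v : EuclideanSpace ℝ (Fin d)) -
  apply Submodule.subset_span
  set φ := extChartAt (𝓡 d) p with hφ
  have hW : IsOpen (φ.target ∩ φ.symm ⁻¹' U) :=
    (continuousOn_extChartAt_symm p).isOpen_inter_preimage (isOpen_extChartAt_target p) hU
  have hpW : φ p ∈ φ.target ∩ φ.symm ⁻¹' U :=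
    ⟨mem_extChartAt_target p, by simpa [hφ] using hp⟩
  obtain ⟨r, hr, hball⟩ := Metric.isOpen_iff.1 hW _ hpW
  set δ : ℝ := r / (‖v‖ + 1) / 2 with hδ
  have hv : 0 < ‖v‖ + 1 := by positivity
  have hδ0 : 0 < δ := by positivity
  have hδr : δ * ‖v‖ < r := by
    have : δ * (‖v‖ + 1) = r / 2 := by rw [hδ]; field_simp
    nlinarith
  set c : ℝ → EuclideanSpace ℝ (Fin d) := fun t => φ p + (δ * Real.sin (t / δ)) • v with hc
  have hcs : ContDiff ℝ ∞ c := by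
    rw [hc]; fun_prop
  have hcW : ∀ t, c t ∈ φ.target ∩ φ.symm ⁻¹' U := by
    intro t
    apply hball
    rw [mem_ball_iff_norm, hc]
    simp only [add_sub_cancel_left, norm_smul, norm_mul, Real.norm_eq_abs, abs_of_pos hδ0]
    have : |Real.sin (t / δ)| ≤ 1 := Real.abs_sin_le_one _
    calc δ * |Real.sin (t / δ)| * ‖v‖ ≤ δ * 1 * ‖v‖ := by gcongr
      _ < r := by simpa using hδr
  have hc0 : c 0 = φ p := by simp [hc]
  have hγ : ContMDiff 𝓘(ℝ, ℝ) (𝓡 d) ∞ (φ.symm ∘ c) :=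
    (contMDiffOn_extChartAt_symm p).comp_contMDiff hcs.contMDiff fun t => (hcW t).1
  refine ⟨φ.symm ∘ c, hγ, fun t => (hcW t).2, by simp [hc0, hφ], ?_⟩
  have hcd : HasDerivAt c v 0 := by
    have h1 : HasDerivAt (fun t : ℝ => δ * Real.sin (t / δ)) 1 0 := by
      have := (((hasDerivAt_id (0 : ℝ)).div_const δ).sin).const_mul δ
      simpa [hδ0.ne'] using this
    simpa [hc] using (h1.smul_const v).const_add (φ p)
  have hcm : HasMFDerivAt 𝓘(ℝ, ℝ) (𝓡 d) c 0 (ContinuousLinearMap.toSpanSingleton ℝ v) :=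
    hcd.hasFDerivAt.hasMFDerivAt
  have hsm : HasMFDerivAt (𝓡 d) (𝓡 d) φ.symm (c 0)
      (ContinuousLinearMap.id ℝ (EuclideanSpace ℝ (Fin d))) := by
    have h0 : MDifferentiableAt (𝓡 d) (𝓡 d) φ.symm (c 0) := by
      rw [hc0]
      exact ((contMDiffOn_extChartAt_symm (I := 𝓡 d) (n := ∞) p).contMDiffAt
        (extChartAt_target_mem_nhds p)).mdifferentiableAt (by simp)
    have h1 : mfderiv (𝓡 d) (𝓡 d) φ.symm (φ p) =
        ContinuousLinearMap.id ℝ (EuclideanSpace ℝ (Fin d)) := by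
      have := mfderivWithin_range_extChartAt_symm (I := 𝓡 d) (x := p)
      rw [ModelWithCorners.Boundaryless.range_eq_univ, mfderivWithin_univ] at this
      exact this
    have h2 := h0.hasMFDerivAt
    rw [hc0] at h2 ⊢
    rw [h1] at h2
    exact h2
  have := (HasMFDerivAt.comp 0 hsm hcm).mfderiv
  rw [this]
  exact one_smul ℝ v

/-! ### Maps into a based Whitney stratified manifold -/

namespace BasedWhit

variable {E : Type*} [NormedAddCommGroup E] [NormedSpace ℝ E] {H : Type*} [TopologicalSpace H]
  {M : Type*} [TopologicalSpace M] [ChartedSpace H M] {I : ModelWithCorners ℝ E H}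

/-- The basepoint is generic, so its normal space is zero and every map is transversal wherever it
takes the value `⋆`. -/
theorem toNormal_surjective_of_eq_base (X : BasedWhit.{u}) {f : M → X} {p : M} (h : f p = X.base)
    {j : X.Index} (hj : f p ∈ X.stratum j) :
    Function.Surjective (toNormal I (𝓡 X.dim) (X.stratum j) f p) := by
  obtain ⟨i, hi, hb⟩ := X.generic
  have hij : i = j := by
    by_contra hne
    exact Set.disjoint_left.1 (X.whitney.disjoint hne) hb (h ▸ hj)
  subst hij
  rw [toNormal_surjective_iff]
  intro w
  exact ⟨0, by rw [tangentTo_eq_top_of_isOpen hi hj]; exact Submodule.mem_top⟩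

open Classical in
/-- The union of two maps at most one of which differs from the basepoint at any given point. -/
noncomputable def join {α : Type*} (X : BasedWhit.{u}) (A B : α → X) (z : α) : X :=
  if B z = X.base then A z else B z

theorem join_of_right {α : Type*} {X : BasedWhit.{u}} {A B : α → X} {z : α} (h : B z = X.base) :
    X.join A B z = A z := if_pos h

theorem join_of_left {α : Type*} {X : BasedWhit.{u}} {A B : α → X} {z : α} (h : A z = X.base) :
    X.join A B z = B z := by
  by_cases hB : B z = X.base
  · rw [join_of_right hB, h, hB]
  · exact if_neg hB

theorem join_comm {α : Type*} {X : BasedWhit.{u}} {A B : α → X}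
    (h : ∀ z, A z = X.base ∨ B z = X.base) : X.join A B = X.join B A := by
  funext z
  rcases h z with h | h
  · rw [join_of_left h, join_of_right h]
  · rw [join_of_left h, join_of_right h]

theorem join_assoc {α : Type*} {X : BasedWhit.{u}} (A B C : α → X) :
    X.join (X.join A B) C = X.join A (X.join B C) := by
  funext z
  by_cases hC : C z = X.base
  · have h : X.join B C z = B z := join_of_right hC
    rw [join_of_right hC, join, join, h]
  · have h : X.join B C z = C z := if_neg hC
    rw [join, if_neg hC, join, h, if_neg hC]

/-- The union of two smooth maps with disjoint supports is smooth, even where the supports touch: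
in a chart which sends the basepoint to `0` the union is the sum. -/
theorem contMDiff_join {X : BasedWhit.{u}} {A B : M → X} (hA : ContMDiff I (𝓡 X.dim) ∞ A)
    (hB : ContMDiff I (𝓡 X.dim) ∞ B) (hAB : ∀ z, A z = X.base ∨ B z = X.base) :
    ContMDiff I (𝓡 X.dim) ∞ (X.join A B) := by
  intro z
  by_cases hBz : B z = X.base
  · by_cases hAz : A z = X.base
    · set φ := extChartAt (𝓡 X.dim) X.base with hφ
      have hs : φ.source ∈ 𝓝 X.base := extChartAt_source_mem_nhds _
      have hsA : ∀ᶠ y in 𝓝 z, A y ∈ φ.source :=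
        hA.continuous.continuousAt.eventually (by rw [hAz]; exact hs)
      have hsB : ∀ᶠ y in 𝓝 z, B y ∈ φ.source :=
        hB.continuous.continuousAt.eventually (by rw [hBz]; exact hs)
      have hcA : ContMDiffAt I 𝓘(ℝ, EuclideanSpace ℝ (Fin X.dim)) ∞ (fun y => φ (A y)) z :=
        ContMDiffAt.comp z (contMDiffAt_extChartAt' (by simp [hAz])) (hA z)
      have hcB : ContMDiffAt I 𝓘(ℝ, EuclideanSpace ℝ (Fin X.dim)) ∞ (fun y => φ (B y)) z :=
        ContMDiffAt.comp z (contMDiffAt_extChartAt' (by simp [hBz])) (hB z)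
      have hsum : ContMDiffAt I 𝓘(ℝ, EuclideanSpace ℝ (Fin X.dim)) ∞
          (fun y => φ (A y) + φ (B y) - φ X.base) z :=
        (hcA.add hcB).sub contMDiffAt_const
      have hv : φ (A z) + φ (B z) - φ X.base = φ X.base := by rw [hAz, hBz, add_sub_cancel_right]
      have hsymm : ContMDiffAt (𝓡 X.dim) (𝓡 X.dim) ∞ φ.symm (φ (A z) + φ (B z) - φ X.base) := by
        rw [hv]
        exact (contMDiffOn_extChartAt_symm X.base).contMDiffAt (extChartAt_target_mem_nhds _)
      refine (ContMDiffAt.comp z hsymm hsum).congr_of_eventuallyEq ?_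
      filter_upwards [hsA, hsB] with y hyA hyB
      rcases hAB y with h | h
      · rw [join_of_left h, Function.comp_apply, h, add_sub_cancel_left, φ.left_inv hyB]
      · rw [join_of_right h, Function.comp_apply, h, add_sub_cancel_right, φ.left_inv hyA]
    · refine (hA z).congr_of_eventuallyEq ?_
      filter_upwards [hA.continuous.continuousAt.eventually_ne hAz] with y hy
      exact join_of_right ((hAB y).resolve_left hy)
  · refine (hB z).congr_of_eventuallyEq ?_
    filter_upwards [hB.continuous.continuousAt.eventually_ne hBz] with y hy
    exact join_of_left ((hAB y).resolve_right hy)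

end BasedWhit

/-! ### Families of transversal maps -/

/-- A smooth family, parametrized by the real line, of transversal maps `(S^n, B^n) → (X, ⋆)`. -/
structure TransversalFamily (n : ℕ) (X : BasedWhit.{u}) where
  toFun : Sph n × ℝ → X
  smooth : ContMDiff ((𝓡 n).prod 𝓘(ℝ, ℝ)) (𝓡 X.dim) ∞ toFun
  surjective : ∀ t x j, toFun (x, t) ∈ X.stratum j →
    Function.Surjective (toNormal (𝓡 n) (𝓡 X.dim) (X.stratum j) (fun y => toFun (y, t)) x)
  map_cap : ∀ t, ∀ x ∈ Sph.cap n, toFun (x, t) = X.base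

namespace TransversalFamily

variable {n : ℕ} {X Y : BasedWhit.{u}}

theorem smooth_slice (F : TransversalFamily n X) (t : ℝ) :
    ContMDiff (𝓡 n) (𝓡 X.dim) ∞ (fun x => F.toFun (x, t)) :=
  F.smooth.comp (contMDiff_id.prodMk contMDiff_const)

/-- The member of a family at time `t`. -/
def slice (F : TransversalFamily n X) (t : ℝ) : TransversalSphere n X where
  toFun x := F.toFun (x, t)
  isTransversal := ⟨F.smooth_slice t, fun p j => F.surjective t p j⟩
  map_cap := F.map_cap t

/-- The constant family. -/
def const (f : TransversalSphere n X) : TransversalFamily n X where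
  toFun z := f.toFun z.1
  smooth := f.isTransversal.smooth.comp contMDiff_fst
  surjective _ x j := f.isTransversal.surjective x j
  map_cap _ := f.map_cap

/-- The union of two families with disjoint supports. -/
noncomputable def join (F G : TransversalFamily n X)
    (h : ∀ z, F.toFun z = X.base ∨ G.toFun z = X.base) : TransversalFamily n X where
  toFun := X.join F.toFun G.toFun
  smooth := BasedWhit.contMDiff_join F.smooth G.smooth h
  surjective t x j hj := by
    by_cases hF : F.toFun (x, t) = X.base
    · by_cases hG : G.toFun (x, t) = X.base
      · exact X.toNormal_surjective_of_eq_base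
          (f := fun y => X.join F.toFun G.toFun (y, t)) ((BasedWhit.join_of_left hF).trans hG) hj
      · refine toNormal_surjective_congr (f := fun y => G.toFun (y, t)) ?_
          (G.surjective t x j (by rwa [BasedWhit.join_of_left hF] at hj))
        filter_upwards [(G.smooth_slice t).continuous.continuousAt.eventually_ne hG] with y hy
        exact (BasedWhit.join_of_left ((h _).resolve_right hy)).symm
    · refine toNormal_surjective_congr (f := fun y => F.toFun (y, t)) ?_
        (F.surjective t x j (by rwa [BasedWhit.join_of_right ((h _).resolve_left hF)] at hj))
      filter_upwards [(F.smooth_slice t).continuous.continuousAt.eventually_ne hF] with y hy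
      exact (BasedWhit.join_of_right ((h _).resolve_left hy)).symm
  map_cap t x hx := (BasedWhit.join_of_left (F.map_cap t x hx)).trans (G.map_cap t x hx)

/-- A family with its time parameter changed by a smooth function. -/
def reparam (F : TransversalFamily n X) (a : ℝ → ℝ) (ha : ContDiff ℝ ∞ a) :
    TransversalFamily n X where
  toFun z := F.toFun (z.1, a z.2)
  smooth := F.smooth.comp (contMDiff_fst.prodMk (ha.contMDiff.comp contMDiff_snd))
  surjective t x j := F.surjective (a t) x j
  map_cap t := F.map_cap (a t)

end TransversalFamily

/-! ### Homotopy through transversal maps -/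

theorem contMDiff_projIcc_smoothTransition :
    ContMDiff 𝓘(ℝ, ℝ) (𝓡∂ 1) ∞
      (fun t : ℝ => projIcc (0 : ℝ) 1 zero_le_one (Real.smoothTransition t)) :=
  (contMDiffOn_projIcc (x := (0 : ℝ)) (y := 1)).comp_contMDiff
    Real.smoothTransition.contDiff.contMDiff
    fun t => ⟨Real.smoothTransition.nonneg t, Real.smoothTransition.le_one t⟩

namespace TransversalSphere

variable {n : ℕ} {X Y : BasedWhit.{u}}

@[ext]
theorem ext {f g : TransversalSphere n X} (h : f.toFun = g.toFun) : f = g := by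
  cases f; cases g; cases h; rfl

/-- A homotopy through transversal maps is the same as a smooth family over the whole real line;
the time parameter of the latter may be chosen to be constant near the two ends. -/
theorem homotopic_iff_exists_family {f g : TransversalSphere n X} :
    f.Homotopic g ↔ ∃ F : TransversalFamily n X, F.slice 0 = f ∧ F.slice 1 = g := by
  constructor
  · rintro ⟨h, hs, ht, hc, ε, hε, hend⟩
    have h0 : ∀ x, h (x, 0) = f.toFun x := fun x => (hend x 0).1 (by simpa using hε)
    have h1 : ∀ x, h (x, 1) = g.toFun x := fun x => (hend x 1).2 (by simpa using hε)
    refine ⟨⟨fun z => h (z.1, projIcc 0 1 zero_le_one (Real.smoothTransition z.2)),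
      hs.comp (contMDiff_fst.prodMk (contMDiff_projIcc_smoothTransition.comp contMDiff_snd)),
      fun t x j => (ht _).surjective x j, fun t x hx => hc _ x hx⟩, ?_, ?_⟩
    · ext x
      simpa [TransversalFamily.slice] using h0 x
    · ext x
      simpa [TransversalFamily.slice] using h1 x
  · rintro ⟨F, rfl, rfl⟩
    -- `smoothTransition (3 t - 1)` is `0` for `t ≤ 1/3` and `1` for `t ≥ 2/3`.
    refine ⟨fun z => F.toFun (z.1, Real.smoothTransition (3 * (z.2 : ℝ) - 1)), ?_,
      fun t => (F.slice (Real.smoothTransition (3 * (t : ℝ) - 1))).isTransversal,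
      fun t x hx => F.map_cap _ x hx, 1 / 3, by norm_num,
      fun x t => ⟨fun h => ?_, fun h => ?_⟩⟩
    · have ha : ContDiff ℝ ∞ fun t : ℝ => Real.smoothTransition (3 * t - 1) :=
        Real.smoothTransition.contDiff.comp (by fun_prop)
      exact F.smooth.comp (contMDiff_fst.prodMk
        ((ha.contMDiff.comp contMDiff_subtypeVal_Icc).comp contMDiff_snd))
    · simp only [TransversalFamily.slice]
      rw [Real.smoothTransition.zero_of_nonpos (by linarith)]
    · simp only [TransversalFamily.slice]
      rw [Real.smoothTransition.one_of_one_le (by linarith)]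

theorem Homotopic.refl (f : TransversalSphere n X) : f.Homotopic f :=
  homotopic_iff_exists_family.2 ⟨.const f, rfl, rfl⟩

theorem Homotopic.symm {f g : TransversalSphere n X} (h : f.Homotopic g) : g.Homotopic f := by
  obtain ⟨F, rfl, rfl⟩ := homotopic_iff_exists_family.1 h
  refine homotopic_iff_exists_family.2
    ⟨F.reparam (fun t => 1 - t) (contDiff_const.sub contDiff_id), ?_, ?_⟩ <;> ext x <;>
    simp [TransversalFamily.slice, TransversalFamily.reparam]

theorem Homotopic.trans {f g k : TransversalSphere n X} (h : f.Homotopic g)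
    (h' : g.Homotopic k) : f.Homotopic k := by
  obtain ⟨F, rfl, hF⟩ := homotopic_iff_exists_family.1 h
  obtain ⟨G, hG, rfl⟩ := homotopic_iff_exists_family.1 h'
  have hFG : ∀ x, F.toFun (x, 1) = G.toFun (x, 0) := fun x =>
    congrFun (congrArg TransversalSphere.toFun (hF.trans hG.symm)) x
  -- Both reparametrized families are equal to the common end for `t` between `1/4` and `1/2`.
  set F' := F.reparam (fun t => Real.smoothTransition (4 * t))
    (Real.smoothTransition.contDiff.comp (by fun_prop)) with hF'
  set G' := G.reparam (fun t => Real.smoothTransition (4 * t - 2))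
    (Real.smoothTransition.contDiff.comp (by fun_prop)) with hG'
  have heq : ∀ x t, 1 / 4 < t → t < 1 / 2 → F'.toFun (x, t) = G'.toFun (x, t) := by
    intro x t h1 h2
    simp only [hF', hG', TransversalFamily.reparam]
    rw [Real.smoothTransition.one_of_one_le (by linarith),
      Real.smoothTransition.zero_of_nonpos (by linarith), hFG]
  set K : Sph n × ℝ → X := fun z => if z.2 < 1 / 2 then F'.toFun z else G'.toFun z with hK
  have hKF : ∀ x t, t < 1 / 2 → K (x, t) = F'.toFun (x, t) := fun x t ht => if_pos ht
  have hKG : ∀ x t, 1 / 4 < t → K (x, t) = G'.toFun (x, t) := by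
    intro x t ht
    by_cases h2 : t < 1 / 2
    · rw [hKF x t h2, heq x t ht h2]
    · exact if_neg h2
  have hslice : ∀ t, (∀ x, K (x, t) = F'.toFun (x, t)) ∨ (∀ x, K (x, t) = G'.toFun (x, t)) := by
    intro t
    rcases lt_or_ge t (1 / 2) with ht | ht
    · exact .inl fun x => hKF x t ht
    · exact .inr fun x => hKG x t (by linarith)
  refine homotopic_iff_exists_family.2 ⟨⟨K, ?_, ?_, ?_⟩, ?_, ?_⟩
  · rintro ⟨x, t⟩
    rcases lt_or_ge t (1 / 2) with ht | ht
    · refine (F'.smooth (x, t)).congr_of_eventuallyEq ?_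
      filter_upwards [(isOpen_Iio.preimage continuous_snd).mem_nhds (show (x, t).2 < 1 / 2 from ht)]
        with z hz
      exact hKF z.1 z.2 hz
    · refine (G'.smooth (x, t)).congr_of_eventuallyEq ?_
      filter_upwards [(isOpen_Ioi.preimage continuous_snd).mem_nhds
        (show 1 / 4 < (x, t).2 from lt_of_lt_of_le (by norm_num) ht)] with z hz
      exact hKG z.1 z.2 hz
  · intro t x j hj
    rcases hslice t with h | h
    · exact toNormal_surjective_congr (.of_eq (funext fun y => (h y).symm))
        (F'.surjective t x j (h x ▸ hj))
    · exact toNormal_surjective_congr (.of_eq (funext fun y => (h y).symm))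
        (G'.surjective t x j (h x ▸ hj))
  · intro t x hx
    rcases hslice t with h | h <;> rw [h]
    · exact F'.map_cap t x hx
    · exact G'.map_cap t x hx
  · ext x
    simp only [TransversalFamily.slice]
    rw [hKF x 0 (by norm_num)]
    simp [hF', TransversalFamily.reparam]
  · ext x
    simp only [TransversalFamily.slice]
    rw [hKG x 1 (by norm_num)]
    simp only [hG', TransversalFamily.reparam]
    rw [Real.smoothTransition.one_of_one_le (by norm_num)]

theorem homotopic_equivalence :
    _root_.Equivalence (TransversalSphere.Homotopic (n := n) (X := X)) :=
  ⟨.refl, .symm, .trans⟩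

end TransversalSphere

/-! ### Stereographic coordinates on the sphere -/

namespace Sph

variable {n : ℕ}

theorem stereographic_symm_ne_base (y : Plane n) :
    (stereographic (norm_pole n)).symm y ≠ base n :=
  stereoInvFun_ne_north_pole (norm_pole n) y

theorem stereographic_symm_stereographic {x : Sph n} (hx : x ≠ base n) :
    (stereographic (norm_pole n)).symm (stereographic (norm_pole n) x) = x :=
  (stereographic (norm_pole n)).left_inv hx

theorem stereographic_stereographic_symm (y : Plane n) :
    stereographic (norm_pole n) ((stereographic (norm_pole n)).symm y) = y :=
  (stereographic (norm_pole n)).right_inv (mem_univ y)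

theorem contMDiff_stereographic_symm :
    ContMDiff 𝓘(ℝ, Plane n) (𝓡 n) ∞ (stereographic (norm_pole n)).symm := by
  have h : ContMDiff 𝓘(ℝ, Plane n) 𝓘(ℝ, EuclideanSpace ℝ (Fin (n + 1))) ∞
      (fun y : Plane n => stereoInvFunAux (pole n) y) :=
    (contDiff_stereoInvFunAux.comp
      (Submodule.subtypeL (Submodule.span ℝ {pole n})ᗮ).contDiff).contMDiff
  have := Fact.mk (@finrank_euclideanSpace_fin ℝ _ (n + 1))
  exact h.codRestrict_sphere fun y => stereoInvFunAux_mem (norm_pole n) y.2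

theorem contMDiffAt_stereographic {x : Sph n} (hx : x ≠ base n) :
    ContMDiffAt (𝓡 n) 𝓘(ℝ, Plane n) ∞ (stereographic (norm_pole n)) x := by
  have hne : innerSL ℝ (pole n) x.1 ≠ (1 : ℝ) := fun h =>
    hx (Subtype.ext ((inner_eq_one_iff_of_norm_eq_one (norm_pole n)
      (norm_eq_of_mem_sphere x)).1 h).symm)
  have hopen : IsOpen {y : EuclideanSpace ℝ (Fin (n + 1)) | innerSL ℝ (pole n) y ≠ (1 : ℝ)} :=
    isOpen_ne.preimage (innerSL ℝ (pole n)).continuous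
  have h : ContDiffAt ℝ ∞ (stereoToFun (pole n)) x.1 :=
    contDiffOn_stereoToFun.contDiffAt (hopen.mem_nhds hne)
  have := Fact.mk (@finrank_euclideanSpace_fin ℝ _ (n + 1))
  exact ContMDiffAt.comp (g := stereoToFun (pole n)) x h.contMDiffAt (contMDiff_coe_sphere x)

theorem base_mem_cap : base n ∈ cap n := by
  simp only [cap, base, mem_ofPred_eq, pole]
  norm_num

theorem cap_mem_nhds_base : cap n ∈ 𝓝 (base n) := by
  have hc : Continuous fun x : Sph n => x.1 (Fin.last n) := by fun_prop
  refine Filter.mem_of_superset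
    ((isOpen_Ioi.preimage hc).mem_nhds (?_ : 3 / 5 < (base n).1 (Fin.last n)))
    fun x hx => le_of_lt (a := (3 / 5 : ℝ)) hx
  simp only [base, pole]
  norm_num

theorem last_stereographic_symm (y : Plane n) :
    ((stereographic (norm_pole n)).symm y).1 (Fin.last n) = (‖y‖ ^ 2 + 4)⁻¹ * (‖y‖ ^ 2 - 4) := by
  have h0 : (y : EuclideanSpace ℝ (Fin (n + 1))) (Fin.last n) = 0 := by
    have := Submodule.mem_orthogonal_singleton_iff_inner_right.1 y.2
    simpa [pole, EuclideanSpace.inner_single_left] using this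
  change ((‖y‖ ^ 2 + 4)⁻¹ • ((4 : ℝ) • (y : EuclideanSpace ℝ (Fin (n + 1))) +
    (‖y‖ ^ 2 - 4) • pole n)) (Fin.last n) = _
  simp [h0]

theorem stereographic_symm_mem_cap {y : Plane n} :
    (stereographic (norm_pole n)).symm y ∈ cap n ↔ 4 ≤ ‖y‖ := by
  rw [cap, mem_ofPred_eq, last_stereographic_symm, ← div_eq_inv_mul,
    le_div_iff₀ (by positivity)]
  constructor <;> intro h <;> nlinarith [norm_nonneg y]

theorem mem_cap_iff {x : Sph n} (hx : x ≠ base n) :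
    x ∈ cap n ↔ 4 ≤ ‖stereographic (norm_pole n) x‖ := by
  rw [← stereographic_symm_mem_cap, stereographic_symm_stereographic hx]

variable [NeZero n]

/-- In stereographic coordinates, the similarity which carries the ball of radius `r` about
`c • axis` to the ball of radius `4` about the origin. The value at the basepoint is junk. -/
noncomputable def zoom (c r : ℝ) (x : Sph n) : Sph n :=
  (stereographic (norm_pole n)).symm
    ((4 / r) • (stereographic (norm_pole n) x - c • axis n))

theorem zoom_ne_base (c r : ℝ) (x : Sph n) : zoom c r x ≠ base n :=
  stereographic_symm_ne_base _

theorem stereographic_zoom (c r : ℝ) (x : Sph n) :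
    stereographic (norm_pole n) (zoom c r x) =
      (4 / r) • (stereographic (norm_pole n) x - c • axis n) :=
  stereographic_stereographic_symm _

theorem zoom_mem_cap {c r : ℝ} (hr : 0 < r) {x : Sph n}
    (h : r ≤ ‖stereographic (norm_pole n) x - c • axis n‖) : zoom c r x ∈ cap n := by
  rw [zoom, stereographic_symm_mem_cap, norm_smul, Real.norm_of_nonneg (by positivity)]
  calc (4 : ℝ) = 4 / r * r := by field_simp
    _ ≤ _ := by gcongr

theorem zoom_mem_cap_of_mem_cap {c r : ℝ} (hr : 0 < r) (hc : |c| + r ≤ 4) {x : Sph n}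
    (hx : x ≠ base n) (h : x ∈ cap n) : zoom c r x ∈ cap n := by
  apply zoom_mem_cap hr
  have h1 := (mem_cap_iff hx).1 h
  have h2 := norm_sub_norm_le (stereographic (norm_pole n) x) (c • axis n)
  rw [norm_smul, norm_axis, mul_one, Real.norm_eq_abs] at h2
  linarith

theorem zoom_zoom {c r c' r' : ℝ} (hr : r ≠ 0) (hr' : r' ≠ 0) (x : Sph n) :
    zoom c r (zoom c' r' x) = zoom (c' + r' * c / 4) (r * r' / 4) x := by
  rw [zoom, stereographic_zoom, zoom]
  congr 1
  match_scalars <;> field_simp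
  ring

theorem zoom_zero_four {x : Sph n} (hx : x ≠ base n) : zoom 0 4 x = x := by
  simp [zoom, stereographic_symm_stereographic hx]

/-- Discs with centres on the axis at distance at least the sum of their radii are disjoint. -/
theorem zoom_mem_cap_or {c r c' r' : ℝ} (hr : 0 < r) (hr' : 0 < r') (h : r + r' ≤ |c - c'|)
    (x : Sph n) : zoom c r x ∈ cap n ∨ zoom c' r' x ∈ cap n := by
  set y := stereographic (norm_pole n) x with hy
  by_cases h1 : r ≤ ‖y - c • axis n‖
  · exact .inl (zoom_mem_cap hr h1)
  · refine .inr (zoom_mem_cap hr' ?_)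
    have h2 : |c - c'| = ‖(y - c' • axis n) - (y - c • axis n)‖ := by
      rw [sub_sub_sub_cancel_left, ← sub_smul, norm_smul, norm_axis, mul_one, Real.norm_eq_abs]
    have h3 := norm_sub_le (y - c' • axis n) (y - c • axis n)
    rw [← hy]
    linarith

theorem contMDiffAt_zoom {E : Type*} [NormedAddCommGroup E] [NormedSpace ℝ E] {H : Type*}
    [TopologicalSpace H] {M : Type*} [TopologicalSpace M] [ChartedSpace H M]
    {I : ModelWithCorners ℝ E H} {c r : M → ℝ} {g : M → Sph n} {p : M}
    (hc : ContMDiffAt I 𝓘(ℝ, ℝ) ∞ c p) (hr : ContMDiffAt I 𝓘(ℝ, ℝ) ∞ r p) (hr0 : r p ≠ 0)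
    (hg : ContMDiffAt I (𝓡 n) ∞ g p) (hgp : g p ≠ base n) :
    ContMDiffAt I (𝓡 n) ∞ (fun z => zoom (c z) (r z) (g z)) p := by
  have hinv : ContMDiffAt I 𝓘(ℝ, ℝ) ∞ (fun z => 4 / r z) p :=
    ContMDiffAt.comp p (g := fun u : ℝ => 4 / u)
      (contDiffAt_const.div contDiffAt_id hr0).contMDiffAt hr
  have hσ : ContMDiffAt I 𝓘(ℝ, Plane n) ∞ (fun z => stereographic (norm_pole n) (g z)) p :=
    ContMDiffAt.comp p (contMDiffAt_stereographic hgp) hg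
  exact contMDiff_stereographic_symm.contMDiffAt.comp p
    (hinv.smul (hσ.sub (hc.smul contMDiffAt_const)))

/-- The zooms are local diffeomorphisms, the inverse of a similarity being a similarity. -/
theorem mfderiv_zoom_surjective {c r : ℝ} (hr : r ≠ 0) {x : Sph n} (hx : x ≠ base n) :
    Function.Surjective (mfderiv (𝓡 n) (𝓡 n) (zoom c r) x) := by
  have hsm : ∀ {c r : ℝ}, r ≠ 0 → ∀ {x : Sph n}, x ≠ base n →
      MDifferentiableAt (𝓡 n) (𝓡 n) (zoom c r) x := fun hr _ hx =>
    (contMDiffAt_zoom (c := fun _ => _) (r := fun _ => _) contMDiffAt_const contMDiffAt_const hr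
      contMDiffAt_id hx).mdifferentiableAt (by simp)
  have hr' : 16 / r ≠ 0 := by positivity
  -- The inverse of `y ↦ (4 / r) (y - c e)` is `y ↦ (r / 4) (y + (4 c / r) e)`.
  refine mfderiv_surjective_of_rightInverse (η := zoom (-(4 * c / r)) (16 / r)) (hsm hr hx)
    (hsm hr' (zoom_ne_base _ _ _)) ?_ ?_
  · rw [zoom_zoom hr' hr]
    have h1 : c + r * (-(4 * c / r)) / 4 = 0 := by field_simp; ring
    have h2 : 16 / r * r / 4 = 4 := by field_simp; norm_num
    rw [h1, h2, zoom_zero_four hx]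
  · filter_upwards [isOpen_ne.mem_nhds (zoom_ne_base c r x)] with y hy
    rw [Function.comp_apply, zoom_zoom hr hr']
    have h1 : -(4 * c / r) + 16 / r * c / 4 = 0 := by field_simp; ring
    have h2 : r * (16 / r) / 4 = 4 := by field_simp; norm_num
    rw [h1, h2, zoom_zero_four hy, id]

/-! ### The reflection -/

/-- The reflection of `Plane n` in the hyperplane orthogonal to the axis. -/
noncomputable def planeReflection (y : Plane n) : Plane n := y - (2 * inner ℝ (axis n) y) • axis n

theorem planeReflection_smul_sub (a c : ℝ) (y : Plane n) :
    planeReflection (a • (y - c • axis n)) = a • (planeReflection y - (-c) • axis n) := by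
  have h : inner ℝ (axis n) (axis n) = (1 : ℝ) := by
    rw [real_inner_self_eq_norm_sq, norm_axis, one_pow]
  simp only [planeReflection, inner_smul_right, inner_sub_right, h]
  module

theorem norm_planeReflection (y : Plane n) : ‖planeReflection y‖ = ‖y‖ := by
  have h : ‖planeReflection y‖ ^ 2 = ‖y‖ ^ 2 := by
    rw [planeReflection, norm_sub_sq_real, norm_smul, norm_axis, inner_smul_right,
      real_inner_comm, mul_one, Real.norm_eq_abs, sq_abs]
    ring
  exact (sq_eq_sq₀ (norm_nonneg _) (norm_nonneg _)).1 h

theorem coe_rho (x : Sph n) : (rho x : EuclideanSpace ℝ (Fin (n + 1))) =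
    x.1 - (2 * inner ℝ (axis n : EuclideanSpace ℝ (Fin (n + 1))) x.1) •
      (axis n : EuclideanSpace ℝ (Fin (n + 1))) := by
  have hn : ‖(axis n : EuclideanSpace ℝ (Fin (n + 1)))‖ = 1 := norm_axis n
  change (Submodule.span ℝ {(axis n : EuclideanSpace ℝ (Fin (n + 1)))})ᗮ.reflection x.1 = _
  rw [Submodule.reflection_orthogonal_apply, Submodule.reflection_singleton_apply]
  simp only [hn]
  simp
  module

theorem rho_stereographic_symm (y : Plane n) :
    rho ((stereographic (norm_pole n)).symm y) =
      (stereographic (norm_pole n)).symm (planeReflection y) := by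
  apply Subtype.ext
  have hp : inner ℝ (axis n : EuclideanSpace ℝ (Fin (n + 1))) (pole n) = (0 : ℝ) :=
    Submodule.mem_orthogonal_singleton_iff_inner_left.1 (axis n).2
  have e : ∀ z : Plane n, ((stereographic (norm_pole n)).symm z).1 =
    (‖z‖ ^ 2 + 4)⁻¹ • ((4 : ℝ) • (z : EuclideanSpace ℝ (Fin (n + 1))) +
      (‖z‖ ^ 2 - 4) • pole n) := fun z => rfl
  rw [coe_rho, e, e, norm_planeReflection, inner_smul_right, inner_add_right, inner_smul_right,
    inner_smul_right, hp, planeReflection, Submodule.coe_sub, Submodule.coe_smul,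
    Submodule.coe_inner]
  module

theorem rho_base : rho (base n) = base n := by
  apply Subtype.ext
  have hp : inner ℝ (axis n : EuclideanSpace ℝ (Fin (n + 1))) (pole n) = (0 : ℝ) :=
    Submodule.mem_orthogonal_singleton_iff_inner_left.1 (axis n).2
  rw [coe_rho]
  change pole n - _ • _ = pole n
  simp only [base]
  rw [hp]
  simp

theorem rho_rho (x : Sph n) : rho (rho x) = x := by
  apply Subtype.ext
  simp [rho]

theorem rho_eq_base_iff {x : Sph n} : rho x = base n ↔ x = base n := by
  constructor
  · intro h
    rw [← rho_rho x, h, rho_base]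
  · rintro rfl
    exact rho_base

theorem stereographic_rho {x : Sph n} (hx : x ≠ base n) :
    stereographic (norm_pole n) (rho x) = planeReflection (stereographic (norm_pole n) x) := by
  conv_lhs => rw [← stereographic_symm_stereographic hx, rho_stereographic_symm,
    stereographic_stereographic_symm]

theorem rho_mem_cap {x : Sph n} (h : x ∈ cap n) : rho x ∈ cap n := by
  by_cases hx : x = base n
  · rw [hx, rho_base]
    exact base_mem_cap
  · rw [mem_cap_iff (mt rho_eq_base_iff.1 hx), stereographic_rho hx, norm_planeReflection]
    exact (mem_cap_iff hx).1 h

/-- The reflection exchanges the discs about `c • axis` and `-c • axis`. -/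
theorem rho_zoom {c r : ℝ} {x : Sph n} (hx : x ≠ base n) :
    rho (zoom c r x) = zoom (-c) r (rho x) := by
  rw [zoom, rho_stereographic_symm, planeReflection_smul_sub, zoom, stereographic_rho hx]

theorem contMDiff_rho : ContMDiff (𝓡 n) (𝓡 n) ∞ (rho (n := n)) := by
  have := Fact.mk (@finrank_euclideanSpace_fin ℝ _ (n + 1))
  have h : ContMDiff (𝓡 n) 𝓘(ℝ, EuclideanSpace ℝ (Fin (n + 1))) ∞ (fun x : Sph n =>
      (Submodule.span ℝ {(axis n : EuclideanSpace ℝ (Fin (n + 1)))})ᗮ.reflection x.1) :=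
    (LinearIsometryEquiv.contDiff _).contMDiff.comp contMDiff_coe_sphere
  exact h.codRestrict_sphere fun x => (rho x).2

theorem mfderiv_rho_surjective (x : Sph n) :
    Function.Surjective (mfderiv (𝓡 n) (𝓡 n) (rho (n := n)) x) :=
  mfderiv_surjective_of_rightInverse (contMDiff_rho.mdifferentiable (by simp) x)
    (contMDiff_rho.mdifferentiable (by simp) _) (rho_rho x) (.of_eq (funext rho_rho))

end Sph

/-! ### Placing a map in a small disc -/

namespace BasedWhit

variable {n : ℕ} [NeZero n] {X : BasedWhit.{u}}

open Classical in
/-- The map `f`, which is supposed to be `⋆` on `B^n`, transplanted to the disc of radius `r` about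
`c • axis`, and extended by `⋆`. -/
noncomputable def place (X : BasedWhit.{u}) (c r : ℝ) (f : Sph n → X) (x : Sph n) : X :=
  if x = Sph.base n then X.base else f (Sph.zoom c r x)

theorem place_base (c r : ℝ) (f : Sph n → X) : X.place c r f (Sph.base n) = X.base :=
  if_pos rfl

theorem place_of_ne {c r : ℝ} {f : Sph n → X} {x : Sph n} (hx : x ≠ Sph.base n) :
    X.place c r f x = f (Sph.zoom c r x) := if_neg hx

theorem place_of_mem_cap {c r : ℝ} (hr : 0 < r) (hc : |c| + r ≤ 4) {f : Sph n → X}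
    (hf : ∀ x ∈ Sph.cap n, f x = X.base) {x : Sph n} (h : x ∈ Sph.cap n) :
    X.place c r f x = X.base := by
  by_cases hx : x = Sph.base n
  · rw [hx, place_base]
  · rw [place_of_ne hx]
    exact hf _ (Sph.zoom_mem_cap_of_mem_cap hr hc hx h)

theorem place_place {c r c' r' : ℝ} (hr : r ≠ 0) (hr' : r' ≠ 0) (f : Sph n → X) :
    X.place c' r' (X.place c r f) = X.place (c' + r' * c / 4) (r * r' / 4) f := by
  funext x
  by_cases hx : x = Sph.base n
  · rw [hx, place_base, place_base]
  · rw [place_of_ne hx, place_of_ne (Sph.zoom_ne_base _ _ _), place_of_ne hx,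
      Sph.zoom_zoom hr hr']

theorem place_zero_four {f : Sph n → X} (hf : f (Sph.base n) = X.base) : X.place 0 4 f = f := by
  funext x
  by_cases hx : x = Sph.base n
  · rw [hx, place_base, hf]
  · rw [place_of_ne hx, Sph.zoom_zero_four hx]

theorem place_join (c r : ℝ) (f g : Sph n → X) :
    X.place c r (X.join f g) = X.join (X.place c r f) (X.place c r g) := by
  funext x
  by_cases hx : x = Sph.base n
  · rw [hx, place_base, join_of_left (place_base _ _ _), place_base]
  · rw [place_of_ne hx, join, join, place_of_ne hx, place_of_ne hx]

theorem place_const (c r : ℝ) : X.place c r (fun _ : Sph n => X.base) = fun _ => X.base :=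
  funext fun _ => ite_self _

theorem place_comp_rho (c r : ℝ) (f : Sph n → X) :
    X.place c r f ∘ Sph.rho = X.place (-c) r (f ∘ Sph.rho) := by
  funext x
  by_cases hx : x = Sph.base n
  · rw [hx, Function.comp_apply, Sph.rho_base, place_base, place_base]
  · rw [Function.comp_apply, place_of_ne (mt Sph.rho_eq_base_iff.1 hx), place_of_ne hx,
      Function.comp_apply, Sph.rho_zoom hx, neg_neg]

theorem place_eq_base_or {c r c' r' : ℝ} (hr : 0 < r) (hr' : 0 < r') (h : r + r' ≤ |c - c'|)
    {f g : Sph n → X} (hf : ∀ x ∈ Sph.cap n, f x = X.base) (hg : ∀ x ∈ Sph.cap n, g x = X.base)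
    (x : Sph n) : X.place c r f x = X.base ∨ X.place c' r' g x = X.base := by
  by_cases hx : x = Sph.base n
  · left
    rw [hx, place_base]
  · rw [place_of_ne hx, place_of_ne hx]
    exact (Sph.zoom_mem_cap_or hr hr' h x).imp (hf _) (hg _)

/-- Beyond the ball of radius `4` the stretching in `collapse` is invisible after composition with a
map which is `⋆` on `B^n`. -/
theorem comp_pinchHalf {f : Sph n → X} (hf : ∀ x ∈ Sph.cap n, f x = X.base) (c : ℝ) (x : Sph n) :
    f (Sph.pinchHalf (c • Sph.axis n) x) = X.place c 1 f x := by
  by_cases hx : x = Sph.base n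
  · rw [Sph.pinchHalf, if_pos hx, hf _ Sph.base_mem_cap, hx, place_base]
  rw [place_of_ne hx, Sph.pinchHalf, if_neg hx, Sph.zoom, div_one]
  set y := (4 : ℝ) • (stereographic (Sph.norm_pole n) x - c • Sph.axis n) with hy
  rw [Sph.collapse]
  by_cases h4 : ‖y‖ ≤ 4
  · rw [if_pos (by linarith), Real.smoothTransition.one_of_one_le (by linarith), inv_one, one_smul]
  have hy4 : f ((stereographic (Sph.norm_pole n)).symm y) = X.base :=
    hf _ (Sph.stereographic_symm_mem_cap.2 (by linarith))
  rw [hy4]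
  split_ifs with h8
  · apply hf
    rw [Sph.stereographic_symm_mem_cap, norm_smul, norm_inv,
      Real.norm_of_nonneg (Real.smoothTransition.nonneg _)]
    have h0 := Real.smoothTransition.pos_of_pos (x := 2 - ‖y‖ / 4) (by linarith)
    have h1 := (one_le_inv₀ h0).2 (Real.smoothTransition.le_one _)
    nlinarith
  · exact hf _ Sph.base_mem_cap

theorem wedgeMap_comp_pinch {f g : Sph n → X} (hf : ∀ x ∈ Sph.cap n, f x = X.base)
    (hg : ∀ x ∈ Sph.cap n, g x = X.base) :
    Sph.wedgeMap f g ∘ Sph.pinch = X.join (X.place (-2) 1 f) (X.place 2 1 g) := by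
  funext x
  have h1 := comp_pinchHalf hf (-2) x
  have h2 := comp_pinchHalf hg 2 x
  have hfb := hf _ Sph.base_mem_cap
  have hgb := hg _ Sph.base_mem_cap
  rw [Function.comp_apply, Sph.wedgeMap]
  split_ifs with h
  · have h' : Sph.pinchHalf ((2 : ℝ) • Sph.axis n) x = Sph.base n := h
    rw [h', hgb] at h2
    exact h1.trans (join_of_right h2.symm).symm
  · have h' : Sph.pinchHalf (-(2 : ℝ) • Sph.axis n) x = Sph.base n :=
      (Sph.pinch x).2.resolve_right h
    rw [h', hfb] at h1
    exact h2.trans (join_of_left h1.symm).symm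

theorem fn_base {X Y : BasedWhit.{u}} (s : X ⟶ Y) : fn s X.base = Y.base := Hom.map_base s

theorem fn_comp_place {X Y : BasedWhit.{u}} (s : X ⟶ Y) (c r : ℝ) (f : Sph n → X) :
    fn s ∘ X.place c r f = Y.place c r (fn s ∘ f) := by
  funext x
  by_cases hx : x = Sph.base n
  · rw [hx, Function.comp_apply, place_base, place_base, fn_base]
  · rw [Function.comp_apply, place_of_ne hx, place_of_ne hx, Function.comp_apply]

theorem fn_comp_join {α : Type*} {X Y : BasedWhit.{u}} (s : X ⟶ Y) {A B : α → X}
    (h : ∀ z, A z = X.base ∨ B z = X.base) :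
    fn s ∘ X.join A B = Y.join (fn s ∘ A) (fn s ∘ B) := by
  funext z
  rcases h z with h | h
  · rw [Function.comp_apply, join_of_left h, join_of_left (by simp [h, fn_base])]
    rfl
  · rw [Function.comp_apply, join_of_right h, join_of_right (by simp [h, fn_base])]
    rfl

end BasedWhit

namespace TransversalFamily

variable {n : ℕ} [NeZero n] {X Y : BasedWhit.{u}}

/-- A family transplanted to a disc which moves with the time. -/
noncomputable def place (F : TransversalFamily n X) (c r : ℝ → ℝ) (hc : ContDiff ℝ ∞ c)
    (hr : ContDiff ℝ ∞ r) (hr0 : ∀ t, 0 < r t) (hcr : ∀ t, |c t| + r t ≤ 4) :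
    TransversalFamily n X where
  toFun z := X.place (c z.2) (r z.2) (fun x => F.toFun (x, z.2)) z.1
  smooth := by
    rintro ⟨x, t⟩
    by_cases hx : x = Sph.base n
    · refine (contMDiffAt_const (c := X.base)).congr_of_eventuallyEq ?_
      have hmem : Prod.fst ⁻¹' Sph.cap n ∈ 𝓝 (x, t) :=
        continuous_fst.continuousAt (by rw [hx]; exact Sph.cap_mem_nhds_base)
      filter_upwards [hmem] with z hz
      exact BasedWhit.place_of_mem_cap (hr0 _) (hcr _) (F.map_cap _) hz
    · have hz : ContMDiffAt ((𝓡 n).prod 𝓘(ℝ, ℝ)) (𝓡 n) ∞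
          (fun z : Sph n × ℝ => Sph.zoom (c z.2) (r z.2) z.1) (x, t) :=
        Sph.contMDiffAt_zoom (hc.contMDiff.comp contMDiff_snd _) (hr.contMDiff.comp contMDiff_snd _)
          (hr0 t).ne' contMDiffAt_fst hx
      refine ((F.smooth _).comp (x, t) (hz.prodMk contMDiffAt_snd)).congr_of_eventuallyEq ?_
      filter_upwards [(isOpen_ne.preimage continuous_fst).mem_nhds
        (show (x, t).1 ≠ Sph.base n from hx)] with z hz
      exact BasedWhit.place_of_ne hz
  surjective t x j hj := by
    by_cases hx : x = Sph.base n
    · refine X.toNormal_surjective_of_eq_base (f := fun y =>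
        X.place (c t) (r t) (fun x => F.toFun (x, t)) y) ?_ hj
      rw [hx, BasedWhit.place_base]
    · have hz : MDifferentiableAt (𝓡 n) (𝓡 n) (Sph.zoom (c t) (r t)) x :=
        (Sph.contMDiffAt_zoom (c := fun _ => c t) (r := fun _ => r t) contMDiffAt_const
          contMDiffAt_const (hr0 t).ne' contMDiffAt_id hx).mdifferentiableAt (by simp)
      have hj' : F.toFun (Sph.zoom (c t) (r t) x, t) ∈ X.stratum j := by
        rwa [BasedWhit.place_of_ne hx] at hj
      refine toNormal_surjective_congr ?_ (toNormal_comp_surjective_of_mfderiv_surjective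
        ((F.smooth_slice t).mdifferentiable (by simp) _) hz
        (Sph.mfderiv_zoom_surjective (hr0 t).ne' hx) (F.surjective t _ j hj'))
      filter_upwards [isOpen_ne.mem_nhds hx] with y hy
      exact (BasedWhit.place_of_ne (f := fun x => F.toFun (x, t)) hy).symm
  map_cap t x hx := BasedWhit.place_of_mem_cap (hr0 t) (hcr t) (F.map_cap t) hx

/-- The product of two families. -/
noncomputable def mul (F G : TransversalFamily n X) : TransversalFamily n X :=
  (F.place (fun _ => -2) (fun _ => 1) contDiff_const contDiff_const (by norm_num)
    (by norm_num)).join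
  (G.place (fun _ => 2) (fun _ => 1) contDiff_const contDiff_const (by norm_num) (by norm_num))
  fun z => BasedWhit.place_eq_base_or one_pos one_pos (by norm_num) (F.map_cap z.2)
    (G.map_cap z.2) z.1

/-- The composite of a family with the reflection. -/
noncomputable def compRho (F : TransversalFamily n X) : TransversalFamily n X where
  toFun z := F.toFun (Sph.rho z.1, z.2)
  smooth := F.smooth.comp ((Sph.contMDiff_rho.comp contMDiff_fst).prodMk contMDiff_snd)
  surjective t x j hj :=
    toNormal_comp_surjective_of_mfderiv_surjective (f := fun y => F.toFun (y, t))
      ((F.smooth_slice t).mdifferentiable (by simp) _)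
      (Sph.contMDiff_rho.mdifferentiable (by simp) _) (Sph.mfderiv_rho_surjective x)
      (F.surjective t _ j hj)
  map_cap t x hx := F.map_cap t _ (Sph.rho_mem_cap hx)

end TransversalFamily

namespace TransversalSphere

variable {n : ℕ} [NeZero n] {X Y : BasedWhit.{u}}

/-- The constant map at the basepoint. -/
noncomputable def one (n : ℕ) (X : BasedWhit.{u}) : TransversalSphere n X where
  toFun _ := X.base
  isTransversal := ⟨contMDiff_const, fun _ _ hj => X.toNormal_surjective_of_eq_base rfl hj⟩
  map_cap _ _ := rfl

/-- The product `(f ∨ g) ∘ μ`, described as the union of `f`, transplanted to the unit disc about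
`-2 • axis`, and `g`, transplanted to the unit disc about `2 • axis`. -/
noncomputable def mul (f g : TransversalSphere n X) : TransversalSphere n X :=
  ((TransversalFamily.const f).mul (.const g)).slice 0

theorem mul_toFun (f g : TransversalSphere n X) :
    (f.mul g).toFun = X.join (X.place (-2) 1 f.toFun) (X.place 2 1 g.toFun) := rfl

theorem mul_toFun_eq_comp_pinch (f g : TransversalSphere n X) :
    (f.mul g).toFun = Sph.wedgeMap f.toFun g.toFun ∘ Sph.pinch :=
  (BasedWhit.wedgeMap_comp_pinch f.map_cap g.map_cap).symm

/-- The composite with the reflection. -/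
noncomputable def compRho (f : TransversalSphere n X) : TransversalSphere n X :=
  (TransversalFamily.const f).compRho.slice 0

theorem compRho_toFun (f : TransversalSphere n X) : f.compRho.toFun = f.toFun ∘ Sph.rho := rfl

theorem mul_homotopic {f f' g g' : TransversalSphere n X} (hf : f.Homotopic f')
    (hg : g.Homotopic g') : (f.mul g).Homotopic (f'.mul g') := by
  obtain ⟨F, rfl, rfl⟩ := homotopic_iff_exists_family.1 hf
  obtain ⟨G, rfl, rfl⟩ := homotopic_iff_exists_family.1 hg
  exact homotopic_iff_exists_family.2 ⟨F.mul G, rfl, rfl⟩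

theorem compRho_homotopic {f f' : TransversalSphere n X} (hf : f.Homotopic f') :
    f.compRho.Homotopic f'.compRho := by
  obtain ⟨F, rfl, rfl⟩ := homotopic_iff_exists_family.1 hf
  exact homotopic_iff_exists_family.2 ⟨F.compRho, rfl, rfl⟩

theorem compRho_compRho (f : TransversalSphere n X) : f.compRho.compRho = f := by
  ext x
  simp [compRho_toFun, Sph.rho_rho]

theorem mul_compRho (f g : TransversalSphere n X) :
    (f.mul g).compRho = g.compRho.mul f.compRho := by
  apply ext
  have h : ∀ A B : Sph n → X, X.join A B ∘ Sph.rho = X.join (A ∘ Sph.rho) (B ∘ Sph.rho) :=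
    fun _ _ => rfl
  rw [compRho_toFun, mul_toFun, mul_toFun, compRho_toFun, compRho_toFun, h,
    BasedWhit.place_comp_rho, BasedWhit.place_comp_rho, neg_neg, BasedWhit.join_comm]
  exact BasedWhit.place_eq_base_or one_pos one_pos (by norm_num) f.compRho.map_cap
    g.compRho.map_cap

/-- The disc carrying `g` in `1 * g` is moved to the centre and blown up. -/
theorem one_mul_homotopic (g : TransversalSphere n X) : ((one n X).mul g).Homotopic g := by
  have hs : ContDiff ℝ ∞ Real.smoothTransition := Real.smoothTransition.contDiff
  refine homotopic_iff_exists_family.2 ⟨(TransversalFamily.const g).place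
    (fun t => 2 - 2 * Real.smoothTransition t) (fun t => 1 + 3 * Real.smoothTransition t)
    (by fun_prop) (by fun_prop) (fun t => ?_) (fun t => ?_), ?_, ?_⟩
  · linarith [Real.smoothTransition.nonneg t]
  · rw [abs_of_nonneg (by linarith [Real.smoothTransition.le_one t])]
    linarith [Real.smoothTransition.le_one t]
  · ext x
    rw [mul_toFun]
    simp only [one, BasedWhit.place_const]
    rw [BasedWhit.join_of_left rfl]
    simp [TransversalFamily.slice, TransversalFamily.place, TransversalFamily.const]
  · apply ext
    refine Eq.trans ?_ (BasedWhit.place_zero_four (g.map_cap _ Sph.base_mem_cap))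
    simp only [TransversalFamily.slice, TransversalFamily.place, TransversalFamily.const,
      Real.smoothTransition.one]
    norm_num

/-- Reflecting the homotopy `1 * f ~ f`. -/
theorem mul_one_homotopic (f : TransversalSphere n X) : (f.mul (one n X)).Homotopic f := by
  have h := compRho_homotopic (one_mul_homotopic f.compRho)
  rwa [mul_compRho, compRho_compRho] at h

/-- Both products are unions of `f`, `g`, `k` in three disjoint discs with centres in this order on
the axis. The conditions on the discs being linear in centres and radii, the discs of the one
product can be moved to those of the other along segments. -/
theorem mul_assoc_homotopic (f g k : TransversalSphere n X) :
    ((f.mul g).mul k).Homotopic (f.mul (g.mul k)) := by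
  set s := Real.smoothTransition with hs'
  have hs : ContDiff ℝ ∞ s := Real.smoothTransition.contDiff
  have h0 : ∀ t, 0 ≤ s t := Real.smoothTransition.nonneg
  have h1 : ∀ t, s t ≤ 1 := Real.smoothTransition.le_one
  let F := (TransversalFamily.const f).place
    (fun t => -(5 / 2) + 1 / 2 * s t) (fun t => 1 / 4 + 3 / 4 * s t) (by fun_prop) (by fun_prop)
    (fun t => by linarith [h0 t])
    (fun t => by rw [abs_of_nonpos (by linarith [h1 t])]; linarith [h0 t, h1 t])
  let G := (TransversalFamily.const g).place
    (fun t => -(3 / 2) + 3 * s t) (fun _ => 1 / 4) (by fun_prop) (by fun_prop)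
    (fun t => by norm_num)
    (fun t => by
      have : |-(3 / 2) + 3 * s t| ≤ 3 / 2 := abs_le.2 ⟨by linarith [h0 t], by linarith [h1 t]⟩
      linarith)
  let K := (TransversalFamily.const k).place
    (fun t => 2 + 1 / 2 * s t) (fun t => 1 - 3 / 4 * s t) (by fun_prop) (by fun_prop)
    (fun t => by linarith [h1 t])
    (fun t => by rw [abs_of_nonneg (by linarith [h0 t])]; linarith [h0 t, h1 t])
  have hFG : ∀ z, F.toFun z = X.base ∨ G.toFun z = X.base := fun z =>
    BasedWhit.place_eq_base_or (by linarith [h0 z.2]) (by norm_num)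
      (by rw [abs_of_nonpos (by linarith [h0 z.2])]; linarith [h0 z.2, h1 z.2])
      f.map_cap g.map_cap z.1
  have hFK : ∀ z, F.toFun z = X.base ∨ K.toFun z = X.base := fun z =>
    BasedWhit.place_eq_base_or (by linarith [h0 z.2]) (by linarith [h1 z.2])
      (by rw [abs_of_nonpos (by linarith [h0 z.2])]; linarith [h0 z.2, h1 z.2])
      f.map_cap k.map_cap z.1
  have hGK : ∀ z, G.toFun z = X.base ∨ K.toFun z = X.base := fun z =>
    BasedWhit.place_eq_base_or (by norm_num) (by linarith [h1 z.2])
      (by rw [abs_of_nonpos (by linarith [h1 z.2])]; linarith [h0 z.2, h1 z.2])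
      g.map_cap k.map_cap z.1
  have hK : ∀ z, (F.join G hFG).toFun z = X.base ∨ K.toFun z = X.base := by
    intro z
    by_cases hz : K.toFun z = X.base
    · exact .inr hz
    · exact .inl ((BasedWhit.join_of_left ((hFK z).resolve_right hz)).trans
        ((hGK z).resolve_right hz))
  have e : ∀ t, (((F.join G hFG).join K hK).slice t).toFun =
      X.join (X.join
        (X.place (-(5 / 2) + 1 / 2 * s t) (1 / 4 + 3 / 4 * s t) f.toFun)
        (X.place (-(3 / 2) + 3 * s t) (1 / 4) g.toFun))
        (X.place (2 + 1 / 2 * s t) (1 - 3 / 4 * s t) k.toFun) := fun _ => rfl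
  refine homotopic_iff_exists_family.2 ⟨(F.join G hFG).join K hK, ext ?_, ext ?_⟩
  · rw [e, mul_toFun, mul_toFun, BasedWhit.place_join,
      BasedWhit.place_place one_ne_zero one_ne_zero,
      BasedWhit.place_place one_ne_zero one_ne_zero, hs', Real.smoothTransition.zero]
    norm_num
  · rw [e, mul_toFun, mul_toFun, BasedWhit.place_join,
      BasedWhit.place_place one_ne_zero one_ne_zero,
      BasedWhit.place_place one_ne_zero one_ne_zero, hs', Real.smoothTransition.one,
      BasedWhit.join_assoc]
    norm_num

end TransversalSphere

/-! ### The dagger monoid -/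

namespace TransversalHomotopySet

open TransversalSphere

variable {n : ℕ} [NeZero n] {X : BasedWhit.{u}}

noncomputable instance : Monoid (TransversalHomotopySet n X) where
  mul := Quot.map₂ TransversalSphere.mul (fun f _ _ h => mul_homotopic (.refl f) h)
    (fun _ _ g h => mul_homotopic h (.refl g))
  one := (TransversalSphere.one n X).cls
  mul_assoc := by
    rintro ⟨f⟩ ⟨g⟩ ⟨k⟩
    exact Quot.sound (mul_assoc_homotopic f g k)
  one_mul := by
    rintro ⟨f⟩
    exact Quot.sound (one_mul_homotopic f)
  mul_one := by
    rintro ⟨f⟩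
    exact Quot.sound (mul_one_homotopic f)

noncomputable instance : StarMul (TransversalHomotopySet n X) where
  star := Quot.map TransversalSphere.compRho fun _ _ => compRho_homotopic
  star_involutive := by
    rintro ⟨f⟩
    exact congrArg TransversalSphere.cls (compRho_compRho f)
  star_mul := by
    rintro ⟨f⟩ ⟨g⟩
    exact congrArg TransversalSphere.cls (mul_compRho f g)

end TransversalHomotopySet

/-! ### Functoriality -/

/-- A stratified normal submersion preserves transversality at a point. -/
theorem IsStratifiedNormalSubmersion.toNormal_comp_surjective {E : Type*} [NormedAddCommGroup E]
    [NormedSpace ℝ E] {H : Type*} [TopologicalSpace H] {M : Type*} [TopologicalSpace M]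
    [ChartedSpace H M] {I : ModelWithCorners ℝ E H} {X Y : BasedWhit.{u}} {s : X → Y}
    (hs : IsStratifiedNormalSubmersion (𝓡 X.dim) (𝓡 Y.dim) X.stratum Y.stratum s) {f : M → X}
    (hf : ContMDiff I (𝓡 X.dim) ∞ f) {p : M}
    (h : ∀ i, f p ∈ X.stratum i →
      Function.Surjective (toNormal I (𝓡 X.dim) (X.stratum i) f p))
    {j : Y.Index} (hj : s (f p) ∈ Y.stratum j) :
    Function.Surjective (toNormal I (𝓡 Y.dim) (Y.stratum j) (s ∘ f) p) := by
  obtain ⟨i, hi⟩ := mem_iUnion.1 (X.whitney.cover ▸ mem_univ (f p) : f p ∈ ⋃ i, X.stratum i)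
  have hij : X.stratum i ⊆ s ⁻¹' Y.stratum j :=
    subset_of_mem_of_stratified X.whitney.disjoint (hs.stratified j) hi hj
  exact _root_.toNormal_comp_surjective hf hs.smooth hij (h i hi) (hs.surjective i j hij _ hi)

/-- The family `s ∘ F_t`. -/
def TransversalFamily.map {n : ℕ} {X Y : BasedWhit.{u}} (s : X ⟶ Y) (F : TransversalFamily n X) :
    TransversalFamily n Y where
  toFun := BasedWhit.fn s ∘ F.toFun
  smooth := (BasedWhit.Hom.isSubmersion s).smooth.comp F.smooth
  surjective t x _ hj := (BasedWhit.Hom.isSubmersion s).toNormal_comp_surjective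
    (F.smooth_slice t) (F.surjective t x) hj
  map_cap t x hx := by rw [Function.comp_apply, F.map_cap t x hx, BasedWhit.fn_base]

namespace TransversalSphere

variable {n : ℕ} {X Y : BasedWhit.{u}}

/-- The composite `s ∘ f`. -/
def map (s : X ⟶ Y) (f : TransversalSphere n X) : TransversalSphere n Y :=
  ((TransversalFamily.const f).map s).slice 0

theorem map_toFun (s : X ⟶ Y) (f : TransversalSphere n X) :
    (f.map s).toFun = BasedWhit.fn s ∘ f.toFun := rfl

theorem map_homotopic (s : X ⟶ Y) {f g : TransversalSphere n X} (h : f.Homotopic g) :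
    (f.map s).Homotopic (g.map s) := by
  obtain ⟨F, rfl, rfl⟩ := homotopic_iff_exists_family.1 h
  exact homotopic_iff_exists_family.2 ⟨F.map s, rfl, rfl⟩

theorem one_map (s : X ⟶ Y) : (one n X).map s = one n Y :=
  ext (funext fun _ => BasedWhit.fn_base s)

theorem mul_map [NeZero n] (s : X ⟶ Y) (f g : TransversalSphere n X) :
    (f.mul g).map s = (f.map s).mul (g.map s) := by
  apply ext
  rw [map_toFun, mul_toFun, mul_toFun, BasedWhit.fn_comp_join, BasedWhit.fn_comp_place,
    BasedWhit.fn_comp_place, map_toFun, map_toFun]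
  exact BasedWhit.place_eq_base_or one_pos one_pos (by norm_num) f.map_cap g.map_cap

/-- The homotopy `h` from `s` to `s'` gives the homotopy `h_t ∘ f`. -/
theorem map_homotopic_map {s s' : X ⟶ Y} (h : BasedWhit.Homotopic s s')
    (f : TransversalSphere n X) : (f.map s).Homotopic (f.map s') := by
  obtain ⟨h, hh, ht, hb, h0, h1⟩ := h
  refine homotopic_iff_exists_family.2 ⟨⟨fun z => h (f.toFun z.1,
    projIcc 0 1 zero_le_one (Real.smoothTransition z.2)),
    hh.smooth.comp ((f.isTransversal.smooth.comp contMDiff_fst).prodMk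
      (contMDiff_projIcc_smoothTransition.comp contMDiff_snd)),
    fun t x j hj => (ht _).toNormal_comp_surjective f.isTransversal.smooth
      (f.isTransversal.surjective x) hj, fun t x hx => ?_⟩, ?_, ?_⟩
  · rw [f.map_cap x hx, hb]
  · ext x
    simpa [TransversalFamily.slice] using (h0 (f.toFun x)).trans (congrFun (map_toFun s f) x).symm
  · ext x
    simpa [TransversalFamily.slice] using (h1 (f.toFun x)).trans (congrFun (map_toFun s' f) x).symm

end TransversalSphere

namespace TransversalHomotopySet

open TransversalSphere

variable {n : ℕ} [NeZero n] {X Y : BasedWhit.{u}}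

/-- The map of dagger monoids `[f] ↦ [s ∘ f]`. -/
noncomputable def map (s : X ⟶ Y) : TransversalHomotopySet n X →⋆* TransversalHomotopySet n Y where
  toFun := Quot.map (TransversalSphere.map s) fun _ _ => map_homotopic s
  map_one' := congrArg TransversalSphere.cls (one_map s)
  map_mul' := by
    rintro ⟨f⟩ ⟨g⟩
    exact congrArg TransversalSphere.cls (mul_map s f g)
  map_star' := by
    rintro ⟨f⟩
    rfl

theorem map_eq_map {s s' : X ⟶ Y} (h : BasedWhit.Homotopic s s') :
    (map s : TransversalHomotopySet n X →⋆* _) = map s' := by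
  apply StarMonoidHom.ext
  rintro ⟨f⟩
  exact Quot.sound (map_homotopic_map h f)

variable (n) in
/-- The functor `ψ_n` from based Whitney stratified manifolds to dagger monoids. -/
noncomputable def functor : BasedWhit.{u} ⥤ DaggerMonCat.{u} where
  obj X := ⟨TransversalHomotopySet n X⟩
  map s := map s
  map_id X := by
    apply StarMonoidHom.ext
    rintro ⟨f⟩
    rfl
  map_comp s r := by
    apply StarMonoidHom.ext
    rintro ⟨f⟩
    rfl

end TransversalHomotopySet


theorem mainTheorem4 (n : ℕ) [NeZero n] :
    (∀ X : BasedWhit.{u}, _root_.Equivalence (TransversalSphere.Homotopic (n := n) (X := X))) ∧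
    ∃ (ψ : BasedWhit.{u} ⥤ DaggerMonCat.{u})
      (e : ∀ X : BasedWhit.{u}, TransversalHomotopySet n X ≃ ψ.obj X),
      (∀ X : BasedWhit.{u}, ∃ c : TransversalSphere n X,
        c.toFun = (fun _ => X.base) ∧ e X c.cls = 1) ∧
      (∀ (X : BasedWhit.{u}) (f g : TransversalSphere n X), ∃ k : TransversalSphere n X,
        k.toFun = Sph.wedgeMap f.toFun g.toFun ∘ Sph.pinch ∧
          e X f.cls * e X g.cls = e X k.cls) ∧
      (∀ (X : BasedWhit.{u}) (f : TransversalSphere n X), ∃ k : TransversalSphere n X,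
        k.toFun = f.toFun ∘ Sph.rho ∧ star (e X f.cls) = e X k.cls) ∧
      (∀ (X Y : BasedWhit.{u}) (s : X ⟶ Y) (f : TransversalSphere n X),
        ∃ k : TransversalSphere n Y,
          k.toFun = BasedWhit.fn s ∘ f.toFun ∧
            DaggerMonCat.fn (ψ.map s) (e X f.cls) = e Y k.cls) ∧
      (∀ (X Y : BasedWhit.{u}) (s s' : X ⟶ Y), BasedWhit.Homotopic s s' →
        ψ.map s = ψ.map s') ∧
      (∀ X Y : BasedWhit.{u}, BasedWhit.HomotopyEquivalent X Y →
        Nonempty (ψ.obj X ≅ ψ.obj Y)) := by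

  have hmap : ∀ (X Y : BasedWhit.{u}) (s s' : X ⟶ Y), BasedWhit.Homotopic s s' →
      (TransversalHomotopySet.functor n).map s = (TransversalHomotopySet.functor n).map s' :=
    fun X Y s s' h => TransversalHomotopySet.map_eq_map h
  refine ⟨fun X => TransversalSphere.homotopic_equivalence, TransversalHomotopySet.functor n,
    fun X => Equiv.refl _, fun X => ⟨.one n X, rfl, rfl⟩,
    fun X f g => ⟨f.mul g, f.mul_toFun_eq_comp_pinch g, rfl⟩, fun X f => ⟨f.compRho, rfl, rfl⟩,
    fun X Y s f => ⟨f.map s, rfl, rfl⟩, hmap, ?_⟩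
  rintro X Y ⟨s, r, hsr, hrs⟩
  refine ⟨⟨(TransversalHomotopySet.functor n).map s, (TransversalHomotopySet.functor n).map r,
    ?_, ?_⟩⟩
  · rw [← Functor.map_comp, hmap _ _ _ _ hsr, CategoryTheory.Functor.map_id]
  · rw [← Functor.map_comp, hmap _ _ _ _ hrs, CategoryTheory.Functor.map_id]
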